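/- Nonhomogeneous frog model on $\mathbb{Z}$: at time $0$ there is one active frog at the origin, $X_j$ sleeping frogs at each site $j\ge 1$, and no frogs at negative sites, where $X_1,X_2,\dots$ are independent $\mathbb{N}$-valued random variables with $\mathbb{P}(X_j\neq 0)>0$ and with $X_{j+1}$ stochastically dominating $X_j$. In discrete time, every active frog performs a nearest-neighbour random walk on $\mathbb{Z}$; a frog that started at $j\ge 0$ steps left with probability $p_j$ and right with probability $1-p_j$, where $\tfrac12<p_j<1$ for all $j\ge 0$ and $p_1\ge p_2\ge\cdots$. When an active frog lands on a site, all frogs sleeping there become active. All random walks are independent of each other and of $(X_j)_{j\ge1}$. The model is called transient if the probability that infinitely many frogs hit the origin is $0$. **Theorem 3.1.** Consider a nonhomogeneous frog model on $\mathbb{Z}$ in which the $X_j$, $j\ge1$, are i.i.d. with $\mathbb{E}[X_1]<\infty$, and $p_j=\tfrac12+a_j$ for $j\ge 1$, where the sequence $g(j)=1/a_j$, $j\ge1$, is concave (that is, $g(j)+g(j+2)\le 2g(j+1)$ for all $j\ge1$). Let $d=\min\{k\ge0:\mathbb{P}(X_1=k)>0\}$, let $f(z)=\mathbb{E}[z^{X_1}]$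 be the probability generating function of $X_1$, and let $$\mathcal{K}=-\int_0^\infty \log f(1-e^{-x})\,dx .$$ Then this integral converges absolutely, and the model is transient if and only if $$\sum_{n=1}^{\infty}\frac{e^{-\mathcal{K}/(4a_n)}}{(a_n)^{d/2}}=\infty .$$ -/

import Mathlib

open MeasureTheory ProbabilityTheory

namespace FrogModel

/-- Number of frogs that start at the site `j` when `x j` frogs are sleeping at each `j ≥ 1`:
the origin carries exactly one frog (which is active at time `0`), so the value `x 0` is ignored.
The sites to the left of the origin carry no frogs. -/
def frogCount (x : ℕ → ℕ) (j : ℕ) : ℕ := if j = 0 then 1 else x j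

/-- Position, `k` steps after its activation, of the `i`-th frog that starts at the site `j`, where
`s j i m` is the `m`-th step of that frog (`m = 0, 1, 2, …`). -/
def position (s : ℕ → ℕ → ℕ → ℤ) (j i k : ℕ) : ℤ := (j : ℤ) + ∑ m ∈ Finset.range k, s j i m

open Classical in
/-- The dynamics in discrete time. `age x s t j` describes the frogs that start at the site `j` at
time `t`: it is `none` if they are still asleep, and `some k` if they are active and have made
exactly `k` steps. At time `0` only the origin is active. From time `t` to time `t + 1` every active
frog makes one step; the sleeping frogs at a site `j` are activated at time `t + 1` when some frog
that was active at time `t` lands on `j` at time `t + 1`. -/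
noncomputable def age (x : ℕ → ℕ) (s : ℕ → ℕ → ℕ → ℤ) : ℕ → ℕ → Option ℕ
  | 0, j => if j = 0 then some 0 else none
  | t + 1, j =>
    match age x s t j with
    | some k => some (k + 1)
    | none =>
      if ∃ l i k : ℕ, i < frogCount x l ∧ age x s t l = some k ∧ position s l i (k + 1) = (j : ℤ)
      then some 0 else none

/-- The set of frogs, written as pairs (starting site, index at that site), that are activated and
are at the origin at some time. -/
def frogsHittingOrigin (x : ℕ → ℕ) (s : ℕ → ℕ → ℕ → ℤ) : Set (ℕ × ℕ) :=
  {q | q.2 < frogCount x q.1 ∧ ∃ t k : ℕ, age x s t q.1 = some k ∧ position s q.1 q.2 k = 0}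

/-- The nonhomogeneous frog model on `ℤ`, realised on a probability space `(Ω, P)`.
`X j` is the number of frogs sleeping at `j ≥ 1` (`X 0` plays no role), `S j i m` is the `m`-th step
of the `i`-th frog that starts at `j`, and `p j` is the probability that a step of a frog that starts
at `j` goes to the left. -/
structure IsNonhomogeneous {Ω : Type*} [MeasurableSpace Ω] (P : Measure Ω)
    (X : ℕ → Ω → ℕ) (S : ℕ → ℕ → ℕ → Ω → ℤ) (p : ℕ → ℝ) : Prop where
  half_lt : ∀ j, 1 / 2 < p j
  lt_one : ∀ j, p j < 1
  /-- The `p j`, `j ≥ 1`, are (weakly) decreasing. -/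
  antitone : ∀ j, 1 ≤ j → p (j + 1) ≤ p j
  measurable_count : ∀ j, 1 ≤ j → Measurable (X j)
  measurable_step : ∀ j i m, Measurable (S j i m)
  count_nonzero : ∀ j, 1 ≤ j → 0 < P {ω | X j ω ≠ 0}
  /-- `X (j + 1)` stochastically dominates `X j`. -/
  dominance : ∀ j, 1 ≤ j → ∀ k : ℕ, P {ω | k ≤ X j ω} ≤ P {ω | k ≤ X (j + 1) ω}
  step_left : ∀ j i m, P {ω | S j i m ω = -1} = ENNReal.ofReal (p j)
  step_right : ∀ j i m, P {ω | S j i m ω = 1} = ENNReal.ofReal (1 - p j)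
  /-- The numbers `X 1, X 2, …` are independent. -/
  indep_count : iIndepFun (fun (j : ℕ) (ω : Ω) => X (j + 1) ω) P
  /-- All steps of all frogs are independent. -/
  indep_step : iIndepFun (fun (q : ℕ × ℕ × ℕ) (ω : Ω) => S q.1 q.2.1 q.2.2 ω) P
  /-- The steps are independent of the initial configuration. -/
  indep_count_step : IndepFun (fun (ω : Ω) (j : ℕ) => X (j + 1) ω)
    (fun (ω : Ω) (q : ℕ × ℕ × ℕ) => S q.1 q.2.1 q.2.2 ω) P

/-- The model is transient if the probability that infinitely many frogs hit the origin is `0`. -/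
def Transient {Ω : Type*} [MeasurableSpace Ω] (P : Measure Ω)
    (X : ℕ → Ω → ℕ) (S : ℕ → ℕ → ℕ → Ω → ℤ) : Prop :=
  P {ω | (frogsHittingOrigin (fun j => X j ω) (fun j i m => S j i m ω)).Infinite} = 0

/-- The probability generating function `z ↦ E[z ^ Y]` of an `ℕ`-valued random variable `Y`. -/
noncomputable def genFun {Ω : Type*} [MeasurableSpace Ω] (P : Measure Ω) (Y : Ω → ℕ) (z : ℝ) : ℝ :=
  ∫ ω, z ^ Y ω ∂P

/-- Concavity of a sequence `g 1, g 2, …` (the value `g 0` plays no role). -/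
def ConcaveSeq (g : ℕ → ℝ) : Prop := ∀ j, 1 ≤ j → g j + g (j + 2) ≤ 2 * g (j + 1)

/-- The constant `-∫₀^∞ log f(1 - e^{-x}) dx`, where `f` is the generating function of `Y`. -/
noncomputable def logConst {Ω : Type*} [MeasurableSpace Ω] (P : Measure Ω) (Y : Ω → ℕ) : ℝ :=
  -∫ x in Set.Ioi (0 : ℝ), Real.log (genFun P Y (1 - Real.exp (-x)))

end FrogModel

namespace FrogModel

/-! Call `n` a gap if no frog starting to the left of `n` would ever reach `n` once activated. A gap
keeps all frogs from `n` on asleep, so only finitely many frogs ever move. Without gaps every site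
is reached; since each walk drifts to the left and infinitely many sites are occupied, infinitely
many frogs then hit the origin. The question is thus whether a gap exists almost surely.

Let G_N be the probability of a gap at N + 1 when the frog at the origin is ignored. If ∑ G_N
converges, a tail of sum less than 1 leaves a positive probability of no distant gap, and the
independent frog at the origin may cover the remaining sites. If it diverges, decompose by the first
gap: drifts weaken to the right, so a gap at m using only frogs from n on is at most as likely as
one at the same distance from the start. This sub-renewal inequality forces the first gap to have
total mass 1 (`one_le_of_renewal`, `transient_iff`).

By gambler's ruin and independence, -log G_N = ∑_{k<N} F(h_{N-k} (k+1)) with F(x) = -log f(1 -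
e^{-x}) and h_j = log((1/2 + a_j)/(1/2 - a_j)), which is close to 4 a_j. With a constant rate h this
is a Riemann sum equal to K/h + (d/2) log h + O(1) for small h and N h² bounded below: F is d times
-log(1 - e^{-x}) plus a bounded decreasing function, and only the logarithmic singularity at 0
creates the second term (`exists_isProfile`).

As F decreases and the rates are smallest at N, the rate h_N gives an upper bound (`gapEnergy_le`).
Concavity of 1/a_j yields a_{N-k} ≤ a_N (1 + 4k/N) for k below N/2, hence a matching lower bound up
to O(1 + 1/(N a_N²)) (`le_gapEnergy`). This error is bounded if N a_N² ≥ 1; otherwise the energy is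
at least c √N, and such terms are summable (`sqrt_le_gapEnergy`). So the two series diverge
together. -/

/-- The walk of the `i`-th frog of the site `j` reaches the level `n` or a site to its right. -/
def Reaches (s : ℕ → ℕ → ℕ → ℤ) (j i n : ℕ) : Prop := ∃ k, (n : ℤ) ≤ position s j i k

/-- None of the frogs that start at a site of `[l, m)` ever reaches `n`. -/
def NoReach (x : ℕ → ℕ) (s : ℕ → ℕ → ℕ → ℤ) (l m n : ℕ) : Prop :=
  ∀ j, l ≤ j → j < m → ∀ i, i < frogCount x j → ¬ Reaches s j i n

/-- None of the frogs that start at a site of `[l, n)` ever reaches `n`. -/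
def Gap (x : ℕ → ℕ) (s : ℕ → ℕ → ℕ → ℤ) (l n : ℕ) : Prop := NoReach x s l n n

/-! ### Deterministic dynamics: gaps and activation. -/

section Dynamics

variable {x : ℕ → ℕ} {s : ℕ → ℕ → ℕ → ℤ}

lemma position_zero (j i : ℕ) : position s j i 0 = j := by simp [position]

lemma position_succ (j i k : ℕ) : position s j i (k + 1) = position s j i k + s j i k := by
  simp [position, Finset.sum_range_succ, add_assoc]

/-- A walk with steps `±1` that gets beyond a level visits the level. -/
lemma exists_position_eq (hs : ∀ j i m, s j i m = -1 ∨ s j i m = 1) {j i n : ℕ} (hj : j < n)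
    (h : Reaches s j i n) : ∃ k, position s j i (k + 1) = n := by
  classical
  obtain ⟨k, hk, hmin⟩ : ∃ k, (n : ℤ) ≤ position s j i k ∧
      ∀ l < k, ¬ (n : ℤ) ≤ position s j i l :=
    ⟨Nat.find h, Nat.find_spec h, fun l hl => Nat.find_min h hl⟩
  cases k with
  | zero => rw [position_zero] at hk; omega
  | succ k =>
    refine ⟨k, ?_⟩
    have h1 := hmin k (Nat.lt_succ_self k)
    rw [position_succ] at hk ⊢
    rcases hs j i k with h2 | h2 <;> omega

lemma exists_position_eq_zero (hs : ∀ j i m, s j i m = -1 ∨ s j i m = 1) {j i : ℕ}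
    (h : ∃ k, position s j i k ≤ 0) : ∃ k, position s j i k = 0 := by
  classical
  obtain ⟨k, hk, hmin⟩ : ∃ k, position s j i k ≤ 0 ∧ ∀ l < k, ¬ position s j i l ≤ 0 :=
    ⟨Nat.find h, Nat.find_spec h, fun l hl => Nat.find_min h hl⟩
  refine ⟨k, ?_⟩
  cases k with
  | zero => rw [position_zero] at hk ⊢; omega
  | succ k =>
    have h1 := hmin k (Nat.lt_succ_self k)
    rw [position_succ] at hk ⊢
    rcases hs j i k with h2 | h2 <;> omega

lemma age_zero_zero : age x s 0 0 = some 0 := by simp [age]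

lemma age_add {t j k : ℕ} (h : age x s t j = some k) (r : ℕ) :
    age x s (t + r) j = some (k + r) := by
  induction r with
  | zero => simpa using h
  | succ r ih =>
    rw [← add_assoc, age, ih]
    rfl

lemma age_succ_ne_none {t j l i k : ℕ} (hi : i < frogCount x l) (ha : age x s t l = some k)
    (hp : position s l i (k + 1) = j) : age x s (t + 1) j ≠ none := by
  rw [age]
  cases h : age x s t j with
  | some k => simp
  | none =>
    simp only
    rw [if_pos ⟨l, i, k, hi, ha, hp⟩]
    simp

lemma exists_age_eq_zero {t j k : ℕ} (h : age x s t j = some k) :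
    ∃ t', age x s t' j = some 0 := by
  induction t generalizing k with
  | zero =>
    rw [age] at h
    split_ifs at h with hj
    subst hj
    exact ⟨0, age_zero_zero⟩
  | succ t ih =>
    cases h' : age x s t j with
    | some k' => exact ih h'
    | none =>
      refine ⟨t + 1, ?_⟩
      rw [age, h'] at h ⊢
      simp only at h ⊢
      split_ifs at h ⊢
      rfl

/-- If there is a gap at `n`, then no site from `n` on is ever reached. -/
lemma age_eq_none_of_gap {n : ℕ} (hn : 1 ≤ n) (h : Gap x s 0 n) (t : ℕ) :
    ∀ j, n ≤ j → age x s t j = none := by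
  induction t with
  | zero =>
    intro j hj
    rw [age, if_neg (by omega)]
  | succ t ih =>
    intro j hj
    rw [age, ih j hj]
    simp only
    rw [if_neg]
    rintro ⟨l, i, k, hi, ha, hp⟩
    have hl : l < n := by
      by_contra hl
      rw [ih l (by omega)] at ha
      cases ha
    exact h l (Nat.zero_le l) hl i hi ⟨k + 1, by rw [hp]; exact_mod_cast hj⟩

/-- Only sites below the gap ever wake up, and each of them holds finitely many frogs. -/
lemma finite_frogsHittingOrigin_of_gap {n : ℕ} (hn : 1 ≤ n) (h : Gap x s 0 n) :
    (frogsHittingOrigin x s).Finite := by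
  have : (⋃ j ∈ Set.Iio n, (fun i => (j, i)) '' Set.Iio (frogCount x j)).Finite :=
    Set.Finite.biUnion (Set.finite_Iio n) fun j _ => (Set.finite_Iio _).image _
  refine this.subset ?_
  rintro ⟨j, i⟩ ⟨hi, t, k, ha, -⟩
  have hj : j < n := by
    by_contra hj
    rw [age_eq_none_of_gap hn h t j (by omega)] at ha
    cases ha
  simp only [Set.mem_iUnion]
  exact ⟨j, hj, i, hi, rfl⟩

/-- Without gaps, all sites are reached. -/
lemma exists_age_of_forall_not_gap (hs : ∀ j i m, s j i m = -1 ∨ s j i m = 1)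
    (h : ∀ n, 1 ≤ n → ¬ Gap x s 0 n) (n : ℕ) : ∃ t, age x s t n = some 0 := by
  induction n using Nat.strong_induction_on with
  | _ n ih =>
    rcases Nat.eq_zero_or_pos n with rfl | hn
    · exact ⟨0, age_zero_zero⟩
    have := h n hn
    simp only [Gap, NoReach, not_forall, not_not] at this
    obtain ⟨j, -, hj, i, hi, hr⟩ := this
    obtain ⟨k, hk⟩ := exists_position_eq hs hj hr
    obtain ⟨t, ht⟩ := ih j hj
    have h1 := age_succ_ne_none hi (age_add ht k) (by rw [zero_add]; exact hk)
    obtain ⟨k', hk'⟩ := Option.ne_none_iff_exists'.mp h1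
    exact exists_age_eq_zero hk'

/-- Every site wakes up, so the frog of index `0` at each occupied site is a distinct visitor of the
origin. -/
lemma infinite_frogsHittingOrigin (hs : ∀ j i m, s j i m = -1 ∨ s j i m = 1)
    (h : ∀ n, 1 ≤ n → ¬ Gap x s 0 n) (hx : {j | x (j + 1) ≠ 0}.Infinite)
    (h0 : ∀ j i, ∃ k, position s j i k = 0) : (frogsHittingOrigin x s).Infinite := by
  have : ((fun j : ℕ => (j + 1, 0)) '' {j | x (j + 1) ≠ 0}).Infinite :=
    hx.image (by intro a _ b _ hab; simpa using hab)
  refine this.mono ?_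
  rintro _ ⟨j, hj, rfl⟩
  obtain ⟨t, ht⟩ := exists_age_of_forall_not_gap hs h (j + 1)
  obtain ⟨k, hk⟩ := h0 (j + 1) 0
  refine ⟨?_, t + k, k, ?_, hk⟩
  · simpa [frogCount, Nat.pos_iff_ne_zero] using hj
  · simpa using age_add ht k

end Dynamics

/-! ### Gambler's ruin for biased walks. -/

section Hitting

open Filter Topology

/-- The probability that a walk with up-probability `q` and down-probability `p` climbs `r` levels
within `N` steps, computed by conditioning on the first step. -/
noncomputable def climbProb (p q : ℝ) : ℕ → ℕ → ℝ
  | _, 0 => 1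
  | 0, _ + 1 => 0
  | N + 1, r + 1 => q * climbProb p q N r + p * climbProb p q N (r + 2)

lemma climbProb_zero_right (p q : ℝ) (N : ℕ) : climbProb p q N 0 = 1 := by
  cases N <;> simp [climbProb]

lemma climbProb_nonneg {p q : ℝ} (hp : 0 ≤ p) (hq : 0 ≤ q) (N r : ℕ) :
    0 ≤ climbProb p q N r := by
  induction N generalizing r with
  | zero => cases r <;> simp [climbProb]
  | succ N ih =>
    cases r with
    | zero => simp [climbProb]
    | succ r =>
      rw [climbProb]
      exact add_nonneg (mul_nonneg hq (ih _)) (mul_nonneg hp (ih _))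

/-- The function `(q / p) ^ r` solves the same recursion, because `p + q = 1`, and dominates the
boundary values at `N = 0` and `r = 0`. -/
lemma climbProb_le {p q : ℝ} (hp : 0 < p) (hq : 0 ≤ q) (hpq : p + q = 1) (N r : ℕ) :
    climbProb p q N r ≤ (q / p) ^ r := by
  induction N generalizing r with
  | zero =>
    cases r with
    | zero => simp [climbProb]
    | succ r => simp only [climbProb]; positivity
  | succ N ih =>
    cases r with
    | zero => simp [climbProb]
    | succ r =>
      rw [climbProb]
      have h1 : q = p * (q / p) := by field_simp
      calc q * climbProb p q N r + p * climbProb p q N (r + 2)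
          ≤ q * (q / p) ^ r + p * (q / p) ^ (r + 2) := by
            gcongr
            · exact ih _
            · exact ih _
        _ = p * (q / p) * (q / p) ^ r + p * (q / p) * ((q / p) ^ (r + 1)) := by
            rw [← h1, pow_succ _ (r + 1), h1]
            field_simp
        _ = (p + p * (q / p)) * (q / p) ^ (r + 1) := by ring
        _ = (q / p) ^ (r + 1) := by rw [← h1, hpq, one_mul]

variable {Ω : Type*}

/-- The event that the walk with steps `ξ` climbs `r` levels within `N` steps. -/
def climbSet (ξ : ℕ → Ω → ℤ) (N r : ℕ) : Set Ω :=
  {ω | ∃ k ≤ N, (r : ℤ) ≤ ∑ m ∈ Finset.range k, ξ m ω}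

lemma measurableSet_climbSet {mΩ : MeasurableSpace Ω} {ξ : ℕ → Ω → ℤ}
    (hξ : ∀ m, Measurable (ξ m)) (N r : ℕ) : MeasurableSet (climbSet ξ N r) := by
  have : climbSet ξ N r = ⋃ k ∈ Set.Iic N, {ω | (r : ℤ) ≤ ∑ m ∈ Finset.range k, ξ m ω} := by
    ext ω; simp [climbSet]
  rw [this]
  refine MeasurableSet.biUnion (Set.to_countable _) fun k _ => ?_
  exact measurableSet_le measurable_const (Finset.measurable_fun_sum _ fun m _ => hξ m)

lemma climbSet_mono {ξ : ℕ → Ω → ℤ} (r : ℕ) : Monotone fun N => climbSet ξ N r := by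
  rintro M N h ω ⟨k, hk, hr⟩
  exact ⟨k, hk.trans h, hr⟩

/-- First-step decomposition; `a` is the height left to climb after a first step `e`. -/
lemma mem_climbSet_succ_of_pos {ξ : ℕ → Ω → ℤ} {N r a : ℕ} {ω : Ω} {e : ℤ} (he : ξ 0 ω = e)
    (ha : (a : ℤ) = r + 1 - e) :
    ω ∈ climbSet ξ (N + 1) (r + 1) ↔ ω ∈ climbSet (fun m => ξ (m + 1)) N a := by
  constructor
  · rintro ⟨k, hk, hr⟩
    cases k with
    | zero => simp at hr; omega
    | succ k =>
      refine ⟨k, by omega, ?_⟩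
      rw [Finset.sum_range_succ', he] at hr
      push_cast at hr
      show (a : ℤ) ≤ ∑ m ∈ Finset.range k, ξ (m + 1) ω
      omega
  · rintro ⟨k, hk, hr⟩
    refine ⟨k + 1, by omega, ?_⟩
    rw [Finset.sum_range_succ', he]
    change (a : ℤ) ≤ ∑ m ∈ Finset.range k, ξ (m + 1) ω at hr
    push_cast
    omega

variable [MeasurableSpace Ω] {P : Measure Ω}

lemma ae_step [IsProbabilityMeasure P] {ξ : Ω → ℤ} (hξ : Measurable ξ) {p q : ℝ} (hp : 0 ≤ p)
    (hq : 0 ≤ q) (hpq : p + q = 1) (hd : P {ω | ξ ω = -1} = ENNReal.ofReal p)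
    (hu : P {ω | ξ ω = 1} = ENNReal.ofReal q) : ∀ᵐ ω ∂P, ξ ω = -1 ∨ ξ ω = 1 := by
  have hm : ∀ a, MeasurableSet {ω | ξ ω = a} := fun a => hξ (measurableSet_singleton a)
  have h : P ({ω | ξ ω = -1} ∪ {ω | ξ ω = 1}) = 1 := by
    rw [measure_union _ (hm 1), hd, hu, ← ENNReal.ofReal_add hp hq, hpq, ENNReal.ofReal_one]
    rw [Set.disjoint_left]
    intro ω h1 h2
    simp only [Set.mem_ofPred_eq] at h1 h2
    omega
  have := (prob_compl_eq_zero_iff ((hm (-1)).union (hm 1))).2 h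
  exact this

/-- Conditioning on the first step reproduces the recursion of `climbProb`. The walk is quantified
inside the induction on `N` because the hypothesis is applied to the shifted walk. -/
lemma measure_climbSet [IsProbabilityMeasure P] {p q : ℝ} (hp : 0 ≤ p) (hq : 0 ≤ q)
    (hpq : p + q = 1) (N : ℕ) : ∀ (r : ℕ) (ξ : ℕ → Ω → ℤ), (∀ m, Measurable (ξ m)) →
    iIndepFun ξ P → (∀ m, P {ω | ξ m ω = -1} = ENNReal.ofReal p) →
    (∀ m, P {ω | ξ m ω = 1} = ENNReal.ofReal q) →
    P (climbSet ξ N r) = ENNReal.ofReal (climbProb p q N r) := by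
  have huniv : ∀ (N : ℕ) (ξ : ℕ → Ω → ℤ), climbSet ξ N 0 = Set.univ := fun N ξ =>
    Set.eq_univ_of_forall fun ω => ⟨0, Nat.zero_le _, by simp⟩
  induction N with
  | zero =>
    intro r ξ _ _ _ _
    cases r with
    | zero => simp [huniv, climbProb]
    | succ r =>
      have : climbSet ξ 0 (r + 1) = ∅ := by
        ext ω
        simp only [climbSet, Set.mem_ofPred_eq, Set.mem_empty_iff_false, iff_false]
        rintro ⟨k, hk, h⟩
        obtain rfl : k = 0 := by omega
        simp at h
        omega
      simp [this, climbProb]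
  | succ N ih =>
    intro r ξ hξ hind hd hu
    cases r with
    | zero => simp [huniv, climbProb]
    | succ r =>
      set η : ℕ → Ω → ℤ := fun m => ξ (m + 1) with hη
      have hIH : ∀ r, P (climbSet η N r) = ENNReal.ofReal (climbProb p q N r) := fun r =>
        ih r η (fun m => hξ _) (hind.precomp (add_left_injective 1)) (fun m => hd _)
          (fun m => hu _)
      have hI : Indep (⨆ i ∈ ({0} : Set ℕ), MeasurableSpace.comap (ξ i) inferInstance)
          (⨆ i ∈ ({0}ᶜ : Set ℕ), MeasurableSpace.comap (ξ i) inferInstance) P :=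
        indep_iSup_of_disjoint (fun i => (hξ i).comap_le) hind disjoint_compl_right
      have hprod : ∀ (e : ℤ) (a : ℕ), P ({ω | ξ 0 ω = e} ∩ climbSet η N a)
          = P {ω | ξ 0 ω = e} * P (climbSet η N a) := by
        intro e a
        refine (Indep_iff _ _ P).1 hI _ _ ?_ ?_
        · have : MeasurableSpace.comap (ξ 0) inferInstance ≤
            ⨆ i ∈ ({0} : Set ℕ), MeasurableSpace.comap (ξ i) inferInstance :=
            le_biSup (fun i => MeasurableSpace.comap (ξ i) inferInstance) (Set.mem_singleton 0)
          exact this _ ⟨{e}, measurableSet_singleton e, rfl⟩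
        · refine @measurableSet_climbSet Ω (_) η (fun m => ?_) N a
          have : MeasurableSpace.comap (ξ (m + 1)) inferInstance ≤
            ⨆ i ∈ ({0}ᶜ : Set ℕ), MeasurableSpace.comap (ξ i) inferInstance :=
            le_biSup (fun i => MeasurableSpace.comap (ξ i) inferInstance) (by simp)
          exact Measurable.mono (comap_measurable _) this le_rfl
      have hae : climbSet ξ (N + 1) (r + 1) =ᵐ[P]
          (({ω | ξ 0 ω = 1} ∩ climbSet η N r) ∪ ({ω | ξ 0 ω = -1} ∩ climbSet η N (r + 2)) :
            Set Ω) := by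
        filter_upwards [ae_step (hξ 0) hp hq hpq (hd 0) (hu 0)] with ω hω
        refine propext ?_
        change ω ∈ climbSet ξ (N + 1) (r + 1) ↔ (ξ 0 ω = 1 ∧ ω ∈ climbSet η N r) ∨
          (ξ 0 ω = -1 ∧ ω ∈ climbSet η N (r + 2))
        rcases hω with h | h
        · rw [mem_climbSet_succ_of_pos (a := r + 2) h (by push_cast; ring)]
          simp [h, hη]
        · rw [mem_climbSet_succ_of_pos (a := r) h (by ring)]
          simp [h, hη]
      rw [measure_congr hae, measure_union, hprod, hprod, hd, hu, hIH, hIH, climbProb,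
        ENNReal.ofReal_add, ENNReal.ofReal_mul hq, ENNReal.ofReal_mul hp]
      · exact mul_nonneg hq (climbProb_nonneg hp hq _ _)
      · exact mul_nonneg hp (climbProb_nonneg hp hq _ _)
      · rw [Set.disjoint_left]
        rintro ω ⟨h1, -⟩ ⟨h2, -⟩
        simp only [Set.mem_ofPred_eq] at h1 h2
        omega
      · exact ((hξ 0) (measurableSet_singleton _)).inter
          (measurableSet_climbSet (fun m => hξ _) _ _)

/-- Solutions of the harmonic recursion that vanish at `0` are multiples of a geometric sum. -/
lemma harmonic_eq {p q : ℝ} (hp : 0 < p) (hpq : p + q = 1) {e : ℕ → ℝ} (h0 : e 0 = 0)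
    (he : ∀ r, e (r + 1) = q * e r + p * e (r + 2)) (r : ℕ) :
    e r = e 1 * ∑ k ∈ Finset.range r, (q / p) ^ k := by
  have hstep : ∀ r, e (r + 1) - e r = e 1 * (q / p) ^ r := by
    intro r
    induction r with
    | zero => simp [h0]
    | succ r ih =>
      have h1 := he r
      have h2 : p * (e (r + 2) - e (r + 1)) = q * (e (r + 1) - e r) := by
        have : q = 1 - p := by linarith
        subst this
        linarith
      rw [ih] at h2
      rw [pow_succ]
      field_simp at h2 ⊢
      linarith
  induction r with
  | zero => simp [h0]
  | succ r ih => rw [Finset.sum_range_succ, mul_add, ← ih, ← hstep]; ring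

/-- The difference `w r - ρ ^ r` is `w 1 - ρ` times a geometric sum that is at least `1`. As `w 1 -
ρ ≤ 0` and `w ≥ 0`, this gives `-ρ ^ (r + 1) ≤ w 1 - ρ ≤ 0`, and the left side tends to `0`. -/
lemma harmonic_eq_pow {p q : ℝ} (hp : 0 < p) (hq : 0 ≤ q) (hqp : q < p) (hpq : p + q = 1)
    {w : ℕ → ℝ} (h0 : w 0 = 1) (hw : ∀ r, w (r + 1) = q * w r + p * w (r + 2))
    (hnn : ∀ r, 0 ≤ w r) (hle : ∀ r, w r ≤ (q / p) ^ r) (r : ℕ) : w r = (q / p) ^ r := by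
  set ρ := q / p with hρ
  have hρ0 : 0 ≤ ρ := by positivity
  have hρ1 : ρ < 1 := by rw [hρ, div_lt_one hp]; exact hqp
  have hqρ : q = p * ρ := by rw [hρ]; field_simp
  have key := harmonic_eq hp hpq (e := fun r => w r - ρ ^ r) (by simp [h0]) (by
    intro r
    rw [hw r]
    have : ρ ^ (r + 1) = q * ρ ^ r + p * ρ ^ (r + 2) := by
      have h1 : q * ρ ^ r + p * ρ ^ (r + 2) = (p + p * ρ) * ρ ^ (r + 1) := by rw [hqρ]; ring
      rw [h1, ← hqρ, hpq, one_mul]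
    rw [this]; ring)
  rw [← hρ] at key
  have hz : w 1 - ρ ^ 1 = 0 := by
    refine le_antisymm (sub_nonpos.2 (hle 1)) ?_
    have ht : Tendsto (fun r : ℕ => -(ρ ^ (r + 1))) atTop (𝓝 (-0)) :=
      ((tendsto_pow_atTop_nhds_zero_of_lt_one hρ0 hρ1).comp (tendsto_add_atTop_nat 1)).neg
    rw [neg_zero] at ht
    refine le_of_tendsto' ht fun r => ?_
    have h1 : (1 : ℝ) ≤ ∑ k ∈ Finset.range (r + 1), ρ ^ k := by
      rw [Finset.sum_range_succ']
      have : 0 ≤ ∑ k ∈ Finset.range r, ρ ^ (k + 1) := Finset.sum_nonneg fun k _ => by positivity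
      simp; linarith
    have h2 := key (r + 1)
    have h3 := hnn (r + 1)
    have h4 : w 1 - ρ ^ 1 ≤ 0 := sub_nonpos.2 (hle 1)
    nlinarith
  have := key r
  rw [hz, zero_mul] at this
  linarith

/-- Here the geometric sum has terms at least `1` and is unbounded, whereas `1 - w` is at most `1`;
so the multiple `1 - w 1` vanishes. -/
lemma harmonic_eq_one {p q : ℝ} (hp : 0 < p) (hpq' : p ≤ q) (hpq : p + q = 1)
    {w : ℕ → ℝ} (h0 : w 0 = 1) (hw : ∀ r, w (r + 1) = q * w r + p * w (r + 2))
    (hnn : ∀ r, 0 ≤ w r) (hle : ∀ r, w r ≤ 1) (r : ℕ) : w r = 1 := by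
  have key := harmonic_eq hp hpq (e := fun r => 1 - w r) (by simp [h0]) (by
    intro r
    rw [hw r]
    linear_combination -hpq)
  have hz : 1 - w 1 = 0 := by
    refine le_antisymm ?_ (sub_nonneg.2 (hle 1))
    by_contra hc
    push Not at hc
    obtain ⟨n, hn⟩ := exists_nat_gt (1 / (1 - w 1))
    have h1 : (n : ℝ) ≤ ∑ k ∈ Finset.range n, (q / p) ^ k := by
      calc (n : ℝ) = ∑ k ∈ Finset.range n, (1 : ℝ) := by simp
        _ ≤ _ := Finset.sum_le_sum fun k _ => one_le_pow₀ ((one_le_div hp).2 hpq')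
    have h2 := key n
    have h3 := hnn n
    rw [div_lt_iff₀ hc] at hn
    nlinarith
  have := key r
  rw [hz, zero_mul] at this
  linarith

/-- Letting the horizon tend to infinity turns the recursion into a harmonic equation. The solution
is not yet identified, since drift to the left and drift to the right select different ones. -/
lemma measure_exists_climb [IsProbabilityMeasure P] {p q : ℝ} (hp : 0 ≤ p) (hq : 0 ≤ q)
    (hpq : p + q = 1) {ξ : ℕ → Ω → ℤ} (hξ : ∀ m, Measurable (ξ m))
    (hind : iIndepFun ξ P) (hd : ∀ m, P {ω | ξ m ω = -1} = ENNReal.ofReal p)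
    (hu : ∀ m, P {ω | ξ m ω = 1} = ENNReal.ofReal q) :
    ∃ w : ℕ → ℝ, (∀ r, 0 ≤ w r) ∧ (∀ r, w r ≤ 1) ∧ (0 < p → ∀ r, w r ≤ (q / p) ^ r) ∧ w 0 = 1 ∧
      (∀ r, w (r + 1) = q * w r + p * w (r + 2)) ∧
      ∀ r : ℕ, P {ω | ∃ k, (r : ℤ) ≤ ∑ m ∈ Finset.range k, ξ m ω} = ENNReal.ofReal (w r) := by
  have hset : ∀ r : ℕ, {ω | ∃ k, (r : ℤ) ≤ ∑ m ∈ Finset.range k, ξ m ω} = ⋃ N, climbSet ξ N r := by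
    intro r
    ext ω
    simp only [climbSet, Set.mem_iUnion, Set.mem_ofPred_eq]
    exact ⟨fun ⟨k, hk⟩ => ⟨k, k, le_rfl, hk⟩, fun ⟨N, k, _, hk⟩ => ⟨k, hk⟩⟩
  set w : ℕ → ℝ := fun r => (P {ω | ∃ k, (r : ℤ) ≤ ∑ m ∈ Finset.range k, ξ m ω}).toReal with hw
  have hlim : ∀ r, Tendsto (fun N => climbProb p q N r) atTop (𝓝 (w r)) := by
    intro r
    have h1 := tendsto_measure_iUnion_atTop (μ := P) (climbSet_mono (ξ := ξ) r)
    rw [← hset r] at h1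
    have h2 := (ENNReal.tendsto_toReal (measure_ne_top P _)).comp h1
    refine h2.congr fun N => ?_
    simp only [Function.comp_apply]
    rw [measure_climbSet hp hq hpq N r ξ hξ hind hd hu,
      ENNReal.toReal_ofReal (climbProb_nonneg hp hq _ _)]
  refine ⟨w, fun r => ENNReal.toReal_nonneg, fun r => measureReal_le_one, fun hp' r => ?_, ?_,
    fun r => ?_, fun r => ?_⟩
  · exact le_of_tendsto' (hlim r) fun N => climbProb_le hp' hq hpq N r
  · refine tendsto_nhds_unique (hlim 0) ?_
    simp [climbProb_zero_right]
  · refine tendsto_nhds_unique ((hlim (r + 1)).comp (tendsto_add_atTop_nat 1)) ?_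
    exact ((hlim r).const_mul q).add ((hlim (r + 2)).const_mul p)
  · rw [hw, ENNReal.ofReal_toReal (measure_ne_top P _)]

/-- A walk with drift to the left climbs `r` levels with probability `(q / p) ^ r`. -/
lemma measure_climb [IsProbabilityMeasure P] {p q : ℝ} (hq : 0 ≤ q) (hqp : q < p)
    (hpq : p + q = 1) {ξ : ℕ → Ω → ℤ} (hξ : ∀ m, Measurable (ξ m))
    (hind : iIndepFun ξ P) (hd : ∀ m, P {ω | ξ m ω = -1} = ENNReal.ofReal p)
    (hu : ∀ m, P {ω | ξ m ω = 1} = ENNReal.ofReal q) (r : ℕ) :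
    P {ω | ∃ k, (r : ℤ) ≤ ∑ m ∈ Finset.range k, ξ m ω} = ENNReal.ofReal ((q / p) ^ r) := by
  have hp : 0 < p := hq.trans_lt hqp
  obtain ⟨w, h1, -, h3, h4, h5, h6⟩ := measure_exists_climb hp.le hq hpq hξ hind hd hu
  rw [h6, harmonic_eq_pow hp hq hqp hpq h4 h5 h1 (h3 hp)]

/-- A walk with drift to the left almost surely visits all levels to the left of its start. -/
lemma ae_descend [IsProbabilityMeasure P] {p q : ℝ} (hq : 0 < q) (hqp : q < p)
    (hpq : p + q = 1) {ξ : ℕ → Ω → ℤ} (hξ : ∀ m, Measurable (ξ m))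
    (hind : iIndepFun ξ P) (hd : ∀ m, P {ω | ξ m ω = -1} = ENNReal.ofReal p)
    (hu : ∀ m, P {ω | ξ m ω = 1} = ENNReal.ofReal q) (r : ℕ) :
    ∀ᵐ ω ∂P, ∃ k, ∑ m ∈ Finset.range k, ξ m ω ≤ -(r : ℤ) := by
  have hp : 0 < p := hq.trans hqp
  -- Descending is climbing for the reflected walk, whose drift points upwards.
  have hind' : iIndepFun (fun m ω => -ξ m ω) P :=
    hind.comp (fun _ z => -z) (fun _ => measurable_neg)
  obtain ⟨w, h1, h2, -, h4, h5, h6⟩ := measure_exists_climb (P := P) hq.le hp.le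
    (by linarith) (ξ := fun m ω => -ξ m ω) (fun m => (hξ m).neg) hind'
    (fun m => by simpa using hu m)
    (fun m => by rw [← hd m]; congr 1; ext ω; simp only [Set.mem_ofPred_eq]; omega)
  have h7 := h6 r
  rw [harmonic_eq_one hq hqp.le (by linarith) h4 h5 h1 h2, ENNReal.ofReal_one] at h7
  have hm : MeasurableSet {ω | ∃ k, (r : ℤ) ≤ ∑ m ∈ Finset.range k, -ξ m ω} := by
    simp only [Set.ofPred_exists]
    exact MeasurableSet.iUnion fun k => measurableSet_le measurable_const
      (Finset.measurable_fun_sum _ fun m _ => (hξ m).neg)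
  have h8 : ∀ᵐ ω ∂P, ∃ k, (r : ℤ) ≤ ∑ m ∈ Finset.range k, -ξ m ω :=
    (prob_compl_eq_zero_iff hm).2 h7
  filter_upwards [h8] with ω ⟨k, hk⟩
  refine ⟨k, ?_⟩
  rw [Finset.sum_neg_distrib] at hk
  omega

end Hitting

/-! ### Independence of blocks. -/

/-- Two mutually independent families, each of them independent, form one independent family. -/
lemma iIndep_sum {Ω ι κ : Type*} {mΩ : MeasurableSpace Ω} {P : Measure Ω}
    {m₁ : ι → MeasurableSpace Ω} {m₂ : κ → MeasurableSpace Ω} (h₁ : iIndep m₁ P) (h₂ : iIndep m₂ P)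
    (h : Indep (⨆ i, m₁ i) (⨆ k, m₂ k) P) : iIndep (Sum.elim m₁ m₂) P := by
  rw [iIndep_iff]
  intro s f hf
  have hs : (⋂ i ∈ s, f i) =
      (⋂ i ∈ s.toLeft, f (Sum.inl i)) ∩ ⋂ k ∈ s.toRight, f (Sum.inr k) := by
    ext ω
    simp [Sum.forall]
  rw [hs, (Indep_iff _ _ P).1 h, h₁.meas_biInter, h₂.meas_biInter]
  · conv_rhs => rw [← s.toLeft_disjSum_toRight, Finset.prod_disjSum]
  · exact fun k hk => hf (Sum.inr k) (Finset.mem_toRight.1 hk)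
  · exact fun i hi => hf (Sum.inl i) (Finset.mem_toLeft.1 hi)
  · exact Finset.measurableSet_biInter _ fun i hi =>
      le_iSup m₁ i _ (hf (Sum.inl i) (Finset.mem_toLeft.1 hi))
  · exact Finset.measurableSet_biInter _ fun k hk =>
      le_iSup m₂ k _ (hf (Sum.inr k) (Finset.mem_toRight.1 hk))

/-- Events that depend on disjoint blocks of an independent family multiply. -/
lemma measure_biInter_of_blocks {Ω ι : Type*} {mΩ : MeasurableSpace Ω} {P : Measure Ω}
    [IsProbabilityMeasure P] {m : ι → MeasurableSpace Ω} (hle : ∀ i, m i ≤ mΩ) (h : iIndep m P)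
    {T : ℕ → Set ι} (hT : Pairwise (Function.onFun Disjoint T)) {E : ℕ → Set Ω}
    (hE : ∀ n, MeasurableSet[⨆ i ∈ T n, m i] (E n)) (s : Finset ℕ) :
    P (⋂ n ∈ s, E n) = ∏ n ∈ s, P (E n) := by
  classical
  induction s using Finset.induction_on with
  | empty => simp
  | insert a s ha ih =>
    rw [Finset.set_biInter_insert, Finset.prod_insert ha, ← ih]
    have hI := indep_iSup_of_disjoint (S := T a) (T := ⋃ n ∈ s, T n) hle h (by
      rw [Set.disjoint_iUnion₂_right]
      intro n hn
      exact hT (fun hna => ha (hna ▸ hn)))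
    refine (Indep_iff _ _ P).1 hI _ _ (hE a) (Finset.measurableSet_biInter _ fun n hn => ?_)
    have : (⨆ i ∈ T n, m i) ≤ ⨆ i ∈ ⋃ n ∈ s, T n, m i :=
      biSup_mono fun i hi => Set.mem_biUnion hn hi
    exact this _ (hE n)

/-! ### Probabilities of gaps. -/

section Gaps

variable {Ω : Type*}

/-- The σ-algebras generated by the numbers of frogs at the sites `1, 2, …` and by the steps. -/
@[reducible]
def infoSpace (X : ℕ → Ω → ℕ) (S : ℕ → ℕ → ℕ → Ω → ℤ) : ℕ ⊕ (ℕ × ℕ × ℕ) → MeasurableSpace Ω :=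
  Sum.elim (fun j => MeasurableSpace.comap (X (j + 1)) inferInstance)
    (fun q => MeasurableSpace.comap (S q.1 q.2.1 q.2.2) inferInstance)

/-- The site to which an index of `infoSpace` belongs. -/
def siteOf : ℕ ⊕ (ℕ × ℕ × ℕ) → ℕ := Sum.elim (fun j => j + 1) (fun q => q.1)

/-- The σ-algebra of the events that are determined by the frogs that start at the sites of `A`. -/
@[reducible]
def siteSpace (X : ℕ → Ω → ℕ) (S : ℕ → ℕ → ℕ → Ω → ℤ) (A : Set ℕ) : MeasurableSpace Ω :=
  ⨆ t ∈ siteOf ⁻¹' A, infoSpace X S t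

variable {X : ℕ → Ω → ℕ} {S : ℕ → ℕ → ℕ → Ω → ℤ}

lemma siteSpace_mono {A B : Set ℕ} (h : A ⊆ B) : siteSpace X S A ≤ siteSpace X S B :=
  biSup_mono fun _ ht => h ht

lemma measurable_count_siteSpace {A : Set ℕ} {j : ℕ} (hj : 1 ≤ j) (hA : j ∈ A) :
    Measurable[siteSpace X S A] (X j) := by
  obtain ⟨j, rfl⟩ := Nat.exists_eq_add_of_le' hj
  have : MeasurableSpace.comap (X (j + 1)) inferInstance ≤ siteSpace X S A :=
    le_biSup (infoSpace X S) (i := Sum.inl j) hA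
  exact Measurable.mono (comap_measurable _) this le_rfl

lemma measurable_step_siteSpace {A : Set ℕ} {j : ℕ} (hA : j ∈ A) (i m : ℕ) :
    Measurable[siteSpace X S A] (S j i m) := by
  have : MeasurableSpace.comap (S j i m) inferInstance ≤ siteSpace X S A :=
    le_biSup (infoSpace X S) (i := Sum.inr (j, i, m)) hA
  exact Measurable.mono (comap_measurable _) this le_rfl

/-- The event that the frog `(j, i)` never reaches `n`. -/
def staySet (S : ℕ → ℕ → ℕ → Ω → ℤ) (j i n : ℕ) : Set Ω :=
  {ω | ¬ Reaches (fun j i m => S j i m ω) j i n}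

/-- The event that no frog that starts at `j` ever reaches `n`. -/
def siteStaySet (X : ℕ → Ω → ℕ) (S : ℕ → ℕ → ℕ → Ω → ℤ) (j n : ℕ) : Set Ω :=
  {ω | ∀ i, i < frogCount (fun j => X j ω) j → ω ∈ staySet S j i n}

/-- The event that no frog that starts in `[l, n)` ever reaches `n`. -/
def gapSet (X : ℕ → Ω → ℕ) (S : ℕ → ℕ → ℕ → Ω → ℤ) (l n : ℕ) : Set Ω :=
  {ω | Gap (fun j => X j ω) (fun j i m => S j i m ω) l n}

lemma measurableSet_staySet {mΩ : MeasurableSpace Ω} {j i : ℕ} (h : ∀ m, Measurable (S j i m))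
    (n : ℕ) : MeasurableSet (staySet S j i n) := by
  have : staySet S j i n = (⋃ k, {ω | (n : ℤ) ≤ j + ∑ m ∈ Finset.range k, S j i m ω})ᶜ := by
    ext ω; simp [staySet, Reaches, position]
  rw [this]
  exact (MeasurableSet.iUnion fun k => measurableSet_le measurable_const
    (measurable_const.add (Finset.measurable_fun_sum _ fun m _ => h m))).compl

lemma measurableSet_siteStaySet {mΩ : MeasurableSpace Ω} {j : ℕ} (hX : 1 ≤ j → Measurable (X j))
    (h : ∀ i m, Measurable (S j i m)) (n : ℕ) : MeasurableSet (siteStaySet X S j n) := by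
  have : siteStaySet X S j n =
      ⋂ i, ({ω | i < frogCount (fun j => X j ω) j}ᶜ ∪ staySet S j i n) := by
    ext ω
    simp only [siteStaySet, Set.mem_iInter, Set.mem_union, Set.mem_compl_iff, Set.mem_ofPred_eq,
      imp_iff_not_or]
  rw [this]
  refine MeasurableSet.iInter fun i => MeasurableSet.union (MeasurableSet.compl ?_)
    (measurableSet_staySet (h i) n)
  rcases Nat.eq_zero_or_pos j with rfl | hj
  · simp [frogCount]
  · simp only [frogCount, if_neg hj.ne']
    exact measurableSet_lt measurable_const (hX hj)

lemma gapSet_eq (l n : ℕ) : gapSet X S l n = ⋂ j ∈ Finset.Ico l n, siteStaySet X S j n := by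
  ext ω
  simp [gapSet, Gap, NoReach, siteStaySet, staySet]

lemma measurableSet_siteStaySet_siteSpace {A : Set ℕ} {j : ℕ} (hj : j ∈ A) (n : ℕ) :
    MeasurableSet[siteSpace X S A] (siteStaySet X S j n) :=
  @measurableSet_siteStaySet Ω X S (siteSpace X S A) j
    (fun h => measurable_count_siteSpace h hj) (measurable_step_siteSpace hj) n

lemma measurableSet_gapSet_siteSpace (l n : ℕ) :
    MeasurableSet[siteSpace X S (Set.Ico l n)] (gapSet X S l n) := by
  rw [gapSet_eq]
  exact Finset.measurableSet_biInter _ fun j hj =>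
    measurableSet_siteStaySet_siteSpace (by simpa using hj) n

variable [MeasurableSpace Ω] {P : Measure Ω} {p : ℕ → ℝ}

lemma IsNonhomogeneous.infoSpace_le (h : IsNonhomogeneous P X S p) (t : ℕ ⊕ (ℕ × ℕ × ℕ)) :
    infoSpace X S t ≤ ‹MeasurableSpace Ω› := by
  rcases t with j | q
  · exact (h.measurable_count (j + 1) (by omega)).comap_le
  · exact (h.measurable_step _ _ _).comap_le

lemma IsNonhomogeneous.siteSpace_le (h : IsNonhomogeneous P X S p) (A : Set ℕ) :
    siteSpace X S A ≤ ‹MeasurableSpace Ω› :=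
  iSup₂_le fun t _ => h.infoSpace_le t

lemma IsNonhomogeneous.measurableSet_gapSet (h : IsNonhomogeneous P X S p) (l n : ℕ) :
    MeasurableSet (gapSet X S l n) :=
  h.siteSpace_le _ _ (measurableSet_gapSet_siteSpace l n)

lemma IsNonhomogeneous.iIndep_infoSpace (h : IsNonhomogeneous P X S p) :
    iIndep (infoSpace X S) P := by
  refine iIndep_sum h.indep_count.iIndep h.indep_step.iIndep ?_
  have := (IndepFun_iff_Indep _ _ P).1 h.indep_count_step
  -- The σ-algebra generated by a whole family is the supremum of those generated by its members.
  rw [MeasurableSpace.pi, MeasurableSpace.pi, MeasurableSpace.comap_iSup,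
    MeasurableSpace.comap_iSup] at this
  simp only [MeasurableSpace.comap_comp] at this
  exact this

lemma IsNonhomogeneous.indep_siteSpace (h : IsNonhomogeneous P X S p) {A B : Set ℕ}
    (hAB : Disjoint A B) : Indep (siteSpace X S A) (siteSpace X S B) P :=
  indep_iSup_of_disjoint h.infoSpace_le h.iIndep_infoSpace (hAB.preimage _)

/-- The probability that a frog from the site `j` ever gets one step to the right. -/
noncomputable def climbRatio (p : ℕ → ℝ) (j : ℕ) : ℝ := (1 - p j) / p j

lemma IsNonhomogeneous.climbRatio_pos (h : IsNonhomogeneous P X S p) (j : ℕ) :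
    0 < climbRatio p j := by
  have h1 := h.half_lt j
  have h2 := h.lt_one j
  exact div_pos (by linarith) (by linarith)

lemma IsNonhomogeneous.climbRatio_lt_one (h : IsNonhomogeneous P X S p) (j : ℕ) :
    climbRatio p j < 1 := by
  have h1 := h.half_lt j
  rw [climbRatio, div_lt_one (by linarith)]
  linarith

/-- The restriction `1 ≤ i` matters: `p 0` is not ordered relative to the other `p j`, which is why
the frog at the origin is treated separately throughout. -/
lemma IsNonhomogeneous.climbRatio_mono (h : IsNonhomogeneous P X S p) {i j : ℕ} (hi : 1 ≤ i)
    (hij : i ≤ j) : climbRatio p i ≤ climbRatio p j := by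
  have hp : p j ≤ p i := by
    induction j, hij using Nat.le_induction with
    | base => exact le_rfl
    | succ j hj ih => exact (h.antitone j (by omega)).trans ih
  have h1 := h.half_lt i
  have h2 := h.half_lt j
  rw [climbRatio, climbRatio, div_le_div_iff₀ (by linarith) (by linarith)]
  nlinarith

lemma IsNonhomogeneous.iIndepFun_steps (h : IsNonhomogeneous P X S p) (j i : ℕ) :
    iIndepFun (fun m => S j i m) P :=
  h.indep_step.precomp (g := fun m : ℕ => ((j, i, m) : ℕ × ℕ × ℕ))
    (by intro a b hab; simpa using hab)

variable [IsProbabilityMeasure P]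

lemma IsNonhomogeneous.measure_gapSet_eq_prod (h : IsNonhomogeneous P X S p) (l n : ℕ) :
    P (gapSet X S l n) = ∏ j ∈ Finset.Ico l n, P (siteStaySet X S j n) := by
  rw [gapSet_eq]
  refine measure_biInter_of_blocks h.infoSpace_le h.iIndep_infoSpace
    (T := fun j => siteOf ⁻¹' {j}) ?_ (fun j => ?_) _
  · intro i j hij
    exact Disjoint.preimage _ (by simpa using hij)
  · exact measurableSet_siteStaySet_siteSpace (A := {j}) rfl n

lemma IsNonhomogeneous.measure_staySet (h : IsNonhomogeneous P X S p) (j i : ℕ) {n : ℕ}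
    (hn : j ≤ n) : P (staySet S j i n) = ENNReal.ofReal (1 - climbRatio p j ^ (n - j)) := by
  have h1 := h.half_lt j
  have h2 := h.lt_one j
  have hc : staySet S j i n = {ω | ∃ k, ((n - j : ℕ) : ℤ) ≤ ∑ m ∈ Finset.range k, S j i m ω}ᶜ := by
    ext ω
    simp only [staySet, Reaches, position, Set.mem_compl_iff, Set.mem_ofPred_eq, not_exists,
      Nat.cast_sub hn, sub_le_iff_le_add']
  have hm := (measurableSet_staySet (h.measurable_step j i) n).compl
  rw [hc, compl_compl] at hm
  rw [hc, prob_compl_eq_one_sub hm, measure_climb (p := p j) (q := 1 - p j) (by linarith)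
    (by linarith) (by ring) (h.measurable_step j i) (h.iIndepFun_steps j i) (h.step_left j i)
    (h.step_right j i), ENNReal.ofReal_sub _ (pow_nonneg (h.climbRatio_pos j).le _),
    ENNReal.ofReal_one, climbRatio]

lemma integrable_pow {Y : Ω → ℕ} (hY : Measurable Y) {z : ℝ} (h0 : 0 ≤ z) (h1 : z ≤ 1) :
    Integrable (fun ω => z ^ Y ω) P := by
  refine Integrable.of_bound (Measurable.aestronglyMeasurable ?_) 1
    (Filter.Eventually.of_forall fun ω => ?_)
  · exact (measurable_of_countable fun k : ℕ => z ^ k).comp hY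
  · rw [Real.norm_of_nonneg (by positivity)]
    exact pow_le_one₀ h0 h1

lemma ofReal_genFun {Y : Ω → ℕ} (hY : Measurable Y) {z : ℝ} (h0 : 0 ≤ z) (h1 : z ≤ 1) :
    ENNReal.ofReal (genFun P Y z) = ∑' k : ℕ, ENNReal.ofReal (z ^ k) * P (Y ⁻¹' {k}) := by
  rw [genFun, ofReal_integral_eq_lintegral_ofReal (integrable_pow hY h0 h1)
    (Filter.Eventually.of_forall fun ω => by positivity),
    ← lintegral_map (f := fun k : ℕ => ENNReal.ofReal (z ^ k)) (measurable_of_countable _) hY,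
    lintegral_countable']
  exact tsum_congr fun k => by rw [Measure.map_apply hY (measurableSet_singleton k)]

/-- Given `X j = k`, the `k` frogs stay below `n` independently, each with probability `z`;
averaging `z ^ k` over `k` gives the generating function. -/
lemma IsNonhomogeneous.measure_siteStaySet (h : IsNonhomogeneous P X S p) {j n : ℕ} (hj : 1 ≤ j)
    (hn : j ≤ n) : P (siteStaySet X S j n) =
      ENNReal.ofReal (genFun P (X j) (1 - climbRatio p j ^ (n - j))) := by
  set z := 1 - climbRatio p j ^ (n - j) with hz
  have hr0 := (h.climbRatio_pos j).le
  have hr1 := (h.climbRatio_lt_one j).le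
  have hz0 : 0 ≤ z := sub_nonneg.2 (pow_le_one₀ hr0 hr1)
  have hz1 : z ≤ 1 := sub_le_self _ (pow_nonneg hr0 _)
  have hXm := h.measurable_count j hj
  have hset : siteStaySet X S j n =
      ⋃ k : ℕ, (X j ⁻¹' {k} ∩ ⋂ i ∈ Finset.range k, staySet S j i n) := by
    ext ω
    have hj0 : j ≠ 0 := by omega
    simp [siteStaySet, frogCount, hj0]
  rw [hset, measure_iUnion, ofReal_genFun hXm hz0 hz1]
  · refine tsum_congr fun k => ?_
    have hle : MeasurableSpace.comap (X j) inferInstance ≤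
        ⨆ t ∈ Set.range Sum.inl, infoSpace X S t := by
      obtain ⟨j, rfl⟩ := Nat.exists_eq_add_of_le' hj
      exact le_biSup (infoSpace X S) (i := Sum.inl j) ⟨j, rfl⟩
    have hstay : ∀ (A : Set (ℕ ⊕ (ℕ × ℕ × ℕ))) (i : ℕ), (∀ m, Sum.inr (j, i, m) ∈ A) →
        MeasurableSet[⨆ t ∈ A, infoSpace X S t] (staySet S j i n) := by
      intro A i hA
      refine @measurableSet_staySet Ω S (⨆ t ∈ A, infoSpace X S t) j i (fun m => ?_) n
      have : MeasurableSpace.comap (S j i m) inferInstance ≤ ⨆ t ∈ A, infoSpace X S t :=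
        le_biSup (infoSpace X S) (i := Sum.inr (j, i, m)) (hA m)
      exact Measurable.mono (comap_measurable _) this le_rfl
    have hI := indep_iSup_of_disjoint (S := Set.range Sum.inl) (T := Set.range Sum.inr)
      h.infoSpace_le h.iIndep_infoSpace (by
        rw [Set.disjoint_left]; rintro _ ⟨a, rfl⟩ ⟨b, hb⟩; cases hb)
    rw [(Indep_iff _ _ P).1 hI _ _ (hle _ ⟨{k}, measurableSet_singleton k, rfl⟩)
      (Finset.measurableSet_biInter _ fun i _ => hstay _ i fun m => ⟨_, rfl⟩), mul_comm]
    congr 1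
    rw [measure_biInter_of_blocks h.infoSpace_le h.iIndep_infoSpace
      (T := fun i => Set.range fun m => Sum.inr (j, i, m)) ?_ (fun i => hstay _ i fun m => ⟨m, rfl⟩)]
    · rw [Finset.prod_congr rfl fun i _ => h.measure_staySet j i hn, ← hz]
      simp [ENNReal.ofReal_pow hz0]
    · intro a b hab
      rw [Function.onFun, Set.disjoint_left]
      rintro _ ⟨m, rfl⟩ ⟨m', hm'⟩
      simp only [Sum.inr.injEq, Prod.mk.injEq, true_and] at hm'
      exact hab hm'.1.symm
  · intro a b hab
    rw [Function.onFun, Set.disjoint_left]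
    rintro ω ⟨h1, -⟩ ⟨h2, -⟩
    exact hab (h1.symm.trans h2)
  · exact fun k => (hXm (measurableSet_singleton k)).inter
      (Finset.measurableSet_biInter _ fun i _ => measurableSet_staySet (h.measurable_step j i) n)

lemma IsNonhomogeneous.measure_siteStaySet_zero (h : IsNonhomogeneous P X S p) (n : ℕ) :
    P (siteStaySet X S 0 n) = ENNReal.ofReal (1 - climbRatio p 0 ^ n) := by
  have : siteStaySet X S 0 n = staySet S 0 0 n := by
    ext ω
    simp [siteStaySet, frogCount]
  rw [this, h.measure_staySet 0 0 (Nat.zero_le n), Nat.sub_zero]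

end Gaps

/-! ### Transience as divergence of the expected number of gaps. -/

section Criterion

open Filter Topology

/-- A sub-renewal inequality with a divergent renewal sequence forces the total mass to be `1`. -/
lemma one_le_of_renewal {G U F : ℕ → ℝ} {ρ c : ℝ} (hG0 : ∀ n, 0 ≤ G n) (hG1 : ∀ n, G n ≤ 1)
    (hF : ∀ n, 0 ≤ F n) (hρ0 : 0 ≤ ρ) (hρ1 : ρ < 1)
    (hU : ∀ m, (1 - ρ ^ (m + 1)) * G m ≤ U m)
    (hr : ∀ m, U m ≤ ∑ n ∈ Finset.range (m + 1), F n * G (m - n))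
    (hc : ∀ M, ∑ n ∈ Finset.range M, F n ≤ c) (hdiv : ¬ Summable G) : 1 ≤ c := by
  set T : ℕ → ℝ := fun M => ∑ m ∈ Finset.range M, G m with hT
  have hT0 : ∀ M, 0 ≤ T M := fun M => Finset.sum_nonneg fun m _ => hG0 m
  have hTlim : Tendsto T atTop atTop :=
    (not_summable_iff_tendsto_nat_atTop_of_nonneg hG0).1 hdiv
  have h1 : ∀ M, ∑ m ∈ Finset.range M, U m ≤ c * T M := by
    intro M
    calc ∑ m ∈ Finset.range M, U m
        ≤ ∑ m ∈ Finset.range M, ∑ n ∈ Finset.range (m + 1), F n * G (m - n) :=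
          Finset.sum_le_sum fun m _ => hr m
      _ = ∑ n ∈ Finset.range M, ∑ m ∈ Finset.Ico n M, F n * G (m - n) := by
          refine Finset.sum_comm' fun m n => ?_
          simp only [Finset.mem_range, Finset.mem_Ico]
          omega
      _ ≤ ∑ n ∈ Finset.range M, F n * T M := by
          refine Finset.sum_le_sum fun n _ => ?_
          rw [← Finset.mul_sum, Finset.sum_Ico_eq_sum_range]
          refine mul_le_mul_of_nonneg_left ?_ (hF n)
          simp only [add_tsub_cancel_left]
          exact Finset.sum_le_sum_of_subset_of_nonneg
            (Finset.range_subset_range.2 (Nat.sub_le M n)) fun m _ _ => hG0 m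
      _ = (∑ n ∈ Finset.range M, F n) * T M := by rw [Finset.sum_mul]
      _ ≤ c * T M := mul_le_mul_of_nonneg_right (hc M) (hT0 M)
  -- The factor `1 - ρ ^ (m + 1)`, due to the frog at the origin, costs at most a geometric series
  -- in total.
  have h2 : ∀ M, T M - 1 / (1 - ρ) ≤ ∑ m ∈ Finset.range M, U m := by
    intro M
    have h3 : ∑ m ∈ Finset.range M, (G m - ρ ^ m) ≤ ∑ m ∈ Finset.range M, U m := by
      refine Finset.sum_le_sum fun m _ => le_trans ?_ (hU m)
      have : ρ ^ (m + 1) * G m ≤ ρ ^ m * 1 :=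
        mul_le_mul (pow_le_pow_of_le_one hρ0 hρ1.le (Nat.le_succ m)) (hG1 m) (hG0 m)
          (pow_nonneg hρ0 m)
      linarith
    have h4 : ∑ m ∈ Finset.range M, ρ ^ m ≤ 1 / (1 - ρ) := by
      rw [one_div, ← tsum_geometric_of_lt_one hρ0 hρ1]
      exact (summable_geometric_of_lt_one hρ0 hρ1).sum_le_tsum _ fun m _ => pow_nonneg hρ0 m
    rw [Finset.sum_sub_distrib] at h3
    linarith
  by_contra hlt
  push Not at hlt
  -- If `c < 1`, then `T M - 1 / (1 - ρ) ≤ c * T M` bounds `T M`, against its divergence.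
  obtain ⟨M, hM⟩ := (hTlim.eventually_gt_atTop (1 / (1 - ρ) / (1 - c))).exists
  rw [div_lt_iff₀ (by linarith)] at hM
  linarith [h1 M, h2 M]

variable {Ω : Type*} [MeasurableSpace Ω] {P : Measure Ω} [IsProbabilityMeasure P]
  {X : ℕ → Ω → ℕ} {S : ℕ → ℕ → ℕ → Ω → ℤ} {p : ℕ → ℝ}

lemma genFun_mono {Y : Ω → ℕ} (hY : Measurable Y) {z w : ℝ} (h0 : 0 ≤ z) (hzw : z ≤ w)
    (h1 : w ≤ 1) : genFun P Y z ≤ genFun P Y w :=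
  integral_mono (integrable_pow hY h0 (hzw.trans h1)) (integrable_pow hY (h0.trans hzw) h1)
    fun _ => pow_le_pow_left₀ h0 hzw _

omit [IsProbabilityMeasure P] in
lemma genFun_nonneg (Y : Ω → ℕ) {z : ℝ} (h0 : 0 ≤ z) : 0 ≤ genFun P Y z :=
  integral_nonneg fun _ => pow_nonneg h0 _

omit [IsProbabilityMeasure P] in
lemma genFun_congr {Y Z : Ω → ℕ} (h : IdentDistrib Y Z P P) (z : ℝ) :
    genFun P Y z = genFun P Z z :=
  (h.comp (measurable_of_countable fun k : ℕ => z ^ k)).integral_eq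

section

variable (h : IsNonhomogeneous P X S p) (hident : ∀ j, 1 ≤ j → IdentDistrib (X j) (X 1) P P)

include h

omit [IsProbabilityMeasure P] in
lemma IsNonhomogeneous.one_sub_climbRatio_mem (j k : ℕ) :
    0 ≤ 1 - climbRatio p j ^ k ∧ 1 - climbRatio p j ^ k ≤ 1 :=
  ⟨sub_nonneg.2 (pow_le_one₀ (h.climbRatio_pos j).le (h.climbRatio_lt_one j).le),
    sub_le_self _ (pow_nonneg (h.climbRatio_pos j).le _)⟩

include hident

lemma IsNonhomogeneous.measure_gapSet (l n : ℕ) (hl : 1 ≤ l) :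
    P (gapSet X S l n) =
      ∏ j ∈ Finset.Ico l n, ENNReal.ofReal (genFun P (X 1) (1 - climbRatio p j ^ (n - j))) := by
  rw [h.measure_gapSet_eq_prod]
  refine Finset.prod_congr rfl fun j hj => ?_
  rw [Finset.mem_Ico] at hj
  rw [h.measure_siteStaySet (hl.trans hj.1) hj.2.le, genFun_congr (hident j (hl.trans hj.1))]

/-- The probability that there is no frog that starts in `[1, N + 1)` and reaches `N + 1`. -/
lemma IsNonhomogeneous.measure_gapSet_one (N : ℕ) :
    P (gapSet X S 1 (N + 1)) = ENNReal.ofReal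
      (∏ k ∈ Finset.range N, genFun P (X 1) (1 - climbRatio p (N - k) ^ (k + 1))) := by
  rw [h.measure_gapSet hident 1 (N + 1) le_rfl, ENNReal.ofReal_prod_of_nonneg
    fun k _ => genFun_nonneg _ (h.one_sub_climbRatio_mem _ _).1, Finset.prod_Ico_eq_prod_range,
    -- Reversing the order indexes the factors by `k`, where the site `N - k` lies at distance `k +
    -- 1` from `N + 1`.
    ← Finset.prod_range_reflect]
  refine Finset.prod_congr (by simp) fun k hk => ?_
  rw [Finset.mem_range] at hk
  have h1 : 1 + (N + 1 - 1 - 1 - k) = N - k := by omega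
  have h2 : N + 1 - (1 + (N + 1 - 1 - 1 - k)) = k + 1 := by omega
  rw [h2, h1]

/-- Translating `[l, n)` to `[1, n - l + 1)` keeps all distances and can only lower the climbing
ratios, so it makes a gap more likely. -/
lemma IsNonhomogeneous.measure_gapSet_le {l n : ℕ} (hl : 1 ≤ l) (hn : l ≤ n) :
    P (gapSet X S l n) ≤ P (gapSet X S 1 (n - l + 1)) := by
  rw [h.measure_gapSet hident l n hl, h.measure_gapSet hident 1 _ le_rfl,
    Finset.prod_Ico_eq_prod_range, Finset.prod_Ico_eq_prod_range]
  simp only [add_tsub_cancel_right]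
  refine Finset.prod_le_prod' fun k hk => ?_
  rw [Finset.mem_range] at hk
  have h1 : n - l + 1 - (1 + k) = n - (l + k) := by omega
  rw [h1]
  refine ENNReal.ofReal_le_ofReal (genFun_mono (h.measurable_count 1 le_rfl)
    (h.one_sub_climbRatio_mem _ _).1 ?_ (h.one_sub_climbRatio_mem _ _).2)
  exact sub_le_sub_left (pow_le_pow_left₀ (h.climbRatio_pos _).le
    (h.climbRatio_mono (by omega) (by omega)) _) _

omit hident in
lemma IsNonhomogeneous.measure_gapSet_zero (n : ℕ) :
    P (gapSet X S 0 (n + 1)) =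
      ENNReal.ofReal (1 - climbRatio p 0 ^ (n + 1)) * P (gapSet X S 1 (n + 1)) := by
  rw [h.measure_gapSet_eq_prod, h.measure_gapSet_eq_prod,
    Finset.prod_eq_prod_Ico_succ_bot (Nat.succ_pos n), h.measure_siteStaySet_zero]

/-- If the expected number of gaps is infinite, then almost surely there is a gap. -/
lemma IsNonhomogeneous.transient_of_tsum_eq_top
    (hsum : ∑' N, P (gapSet X S 1 (N + 1)) = ⊤) : Transient P X S := by
  set B : ℕ → Set Ω := fun n => gapSet X S 0 (n + 1) with hB
  have hBm : ∀ n, MeasurableSet (B n) := fun n => h.measurableSet_gapSet _ _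
  have hD : ∀ n, disjointed B n = B n \ ⋃ k < n, B k := fun n => by
    rw [disjointed_apply, Finset.sup_eq_iSup]
    simp
  -- A first gap at `n + 1`, the event `disjointed B n`, depends only on sites below `n + 1`; it is
  -- therefore independent of gaps built from later sites.
  have hBsite : ∀ n, MeasurableSet[siteSpace X S (Set.Iio (n + 1))] (B n) := fun n =>
    siteSpace_mono Set.Ico_subset_Iio_self _ (measurableSet_gapSet_siteSpace 0 (n + 1))
  have hDsite : ∀ n, MeasurableSet[siteSpace X S (Set.Iio (n + 1))] (disjointed B n) := fun n => by
    rw [hD]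
    refine MeasurableSet.diff (hBsite n) (MeasurableSet.biUnion (Set.to_countable _) fun k hk => ?_)
    exact siteSpace_mono (Set.Iio_subset_Iio (by have : k < n := hk; omega)) _ (hBsite k)
  have hDm : ∀ n, MeasurableSet (disjointed B n) := fun n => h.siteSpace_le _ _ (hDsite n)
  have hone : 1 ≤ (P (⋃ n, B n)).toReal := by
    refine one_le_of_renewal (G := fun n => (P (gapSet X S 1 (n + 1))).toReal)
      (U := fun n => (P (B n)).toReal) (F := fun n => (P (disjointed B n)).toReal)
      (ρ := climbRatio p 0) (fun n => ENNReal.toReal_nonneg) (fun n => measureReal_le_one)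
      (fun n => ENNReal.toReal_nonneg) (h.climbRatio_pos 0).le (h.climbRatio_lt_one 0) ?_ ?_ ?_ ?_
    · intro m
      simp only [hB]
      rw [h.measure_gapSet_zero, ENNReal.toReal_mul,
        ENNReal.toReal_ofReal (h.one_sub_climbRatio_mem _ _).1]
    · intro m
      -- Decomposition by the first gap. For `n = m` the second event concerns an empty interval and
      -- is certain.
      have hsub : B m ⊆ ⋃ n ∈ Finset.range (m + 1),
          (disjointed B n ∩ gapSet X S (n + 1) (m + 1)) := by
        intro ω hω
        have : ω ∈ ⋃ n ∈ Finset.range (m + 1), disjointed B n := by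
          rw [biUnion_range_succ_disjointed]
          exact le_partialSups B m hω
        simp only [Set.mem_iUnion] at this ⊢
        obtain ⟨n, hn, hω'⟩ := this
        exact ⟨n, hn, hω', fun j hj hjm => hω j (Nat.zero_le _) hjm⟩
      have hle : P (B m) ≤ ∑ n ∈ Finset.range (m + 1),
          P (disjointed B n) * P (gapSet X S 1 (m - n + 1)) := by
        refine (measure_mono hsub).trans ((measure_biUnion_finset_le _ _).trans
          (Finset.sum_le_sum fun n hn => ?_))
        rw [Finset.mem_range] at hn
        have hI := h.indep_siteSpace (A := Set.Iio (n + 1)) (B := Set.Ico (n + 1) (m + 1)) (by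
          rw [Set.disjoint_left]
          intro j h1 h2
          exact absurd h2.1 (not_le.2 h1))
        rw [(Indep_iff _ _ P).1 hI _ _ (hDsite n) (measurableSet_gapSet_siteSpace _ _)]
        refine mul_le_mul_right ((h.measure_gapSet_le hident (by omega) (by omega)).trans ?_) _
        rw [show m + 1 - (n + 1) = m - n by omega]
      have := ENNReal.toReal_mono (by simp [ENNReal.sum_eq_top, ENNReal.mul_eq_top]) hle
      rw [ENNReal.toReal_sum (by simp [ENNReal.mul_eq_top])] at this
      simpa only [ENNReal.toReal_mul] using this
    · intro M
      rw [← ENNReal.toReal_sum (by simp), ← measure_biUnion_finset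
        (fun a _ b _ hab => disjoint_disjointed B hab) (fun n _ => hDm n)]
      refine ENNReal.toReal_mono (by simp) (measure_mono ?_)
      exact Set.iUnion₂_subset fun n _ =>
        (disjointed_subset B n).trans (Set.subset_iUnion B n)
    · intro hs
      refine hs.tsum_ofReal_ne_top ?_
      simpa using hsum
  have hP : P (⋃ n, B n) = 1 := by
    refine le_antisymm prob_le_one ?_
    rw [← ENNReal.toReal_one] at hone
    exact (ENNReal.toReal_le_toReal (by simp) (by simp)).1 hone
  refine measure_mono_null ?_ ((prob_compl_eq_zero_iff (MeasurableSet.iUnion hBm)).2 hP)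
  intro ω hω hmem
  obtain ⟨n, hn⟩ := Set.mem_iUnion.1 hmem
  exact hω (finite_frogsHittingOrigin_of_gap (Nat.succ_pos n) hn)

omit hident in
lemma IsNonhomogeneous.ae_steps : ∀ᵐ ω ∂P, ∀ j i m, S j i m ω = -1 ∨ S j i m ω = 1 := by
  simp only [ae_all_iff]
  intro j i m
  have h1 := h.half_lt j
  have h2 := h.lt_one j
  exact ae_step (h.measurable_step j i m) (p := p j) (q := 1 - p j) (by linarith) (by linarith)
    (by ring) (h.step_left j i m) (h.step_right j i m)

omit hident in
lemma IsNonhomogeneous.ae_visit_zero :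
    ∀ᵐ ω ∂P, ∀ j i, ∃ k, position (fun j i m => S j i m ω) j i k ≤ 0 := by
  simp only [ae_all_iff]
  intro j i
  have h1 := h.half_lt j
  have h2 := h.lt_one j
  filter_upwards [ae_descend (p := p j) (q := 1 - p j) (by linarith) (by linarith) (by ring)
    (h.measurable_step j i) (h.iIndepFun_steps j i) (h.step_left j i) (h.step_right j i) j]
    with ω ⟨k, hk⟩
  exact ⟨k, by rw [position]; omega⟩

-- Second Borel–Cantelli lemma: dominance keeps the occupation probabilities above that of the site
-- `1`, so their sum diverges.
omit hident in
lemma IsNonhomogeneous.ae_infinite_nonempty : ∀ᵐ ω ∂P, {j | X (j + 1) ω ≠ 0}.Infinite := by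
  set s : ℕ → Set Ω := fun j => {ω | X (j + 1) ω ≠ 0} with hs
  have hsm : ∀ j, MeasurableSet (s j) := fun j =>
    h.measurable_count (j + 1) (by omega) (measurableSet_singleton 0).compl
  have hind : iIndepSet s P := by
    rw [iIndepSet_iff_meas_biInter hsm]
    intro T
    exact h.indep_count.meas_biInter fun j _ => ⟨{0}ᶜ, (measurableSet_singleton 0).compl, rfl⟩
  have hmono : ∀ j, P (s 0) ≤ P (s j) := by
    intro j
    induction j with
    | zero => exact le_rfl
    | succ j ih =>
      refine ih.trans ?_
      have := h.dominance (j + 1) (by omega) 1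
      simpa only [hs, Nat.one_le_iff_ne_zero] using this
  have hlim := measure_limsup_eq_one hsm hind (by
    refine top_unique (le_trans ?_ (ENNReal.tsum_le_tsum hmono))
    rw [ENNReal.tsum_const_eq_top_of_ne_zero (h.count_nonzero 1 le_rfl).ne'])
  have hae := (prob_compl_eq_zero_iff (MeasurableSet.measurableSet_limsup hsm)).2 hlim
  filter_upwards [show ∀ᵐ ω ∂P, ω ∈ limsup s atTop from hae] with ω hω
  rw [Filter.limsup_eq_iInf_iSup_of_nat] at hω
  simp only [Set.iInf_eq_iInter, Set.iSup_eq_iUnion, Set.mem_iInter, Set.mem_iUnion] at hω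
  refine Set.infinite_of_forall_exists_gt fun n => ?_
  obtain ⟨j, hj, hjs⟩ := hω (n + 1)
  exact ⟨j, hjs, hj⟩

omit hident in
/-- If the expected number of gaps is finite, then with positive probability there is no gap. -/
lemma IsNonhomogeneous.not_transient_of_tsum_ne_top
    (hsum : ∑' N, P (gapSet X S 1 (N + 1)) ≠ ⊤) : ¬ Transient P X S := by
  -- Beyond `N` the gap probabilities sum to less than `1`, so `E₁`, the absence of distant gaps, is
  -- not null; `E₀` makes the origin's frog walk straight to `N`.
  obtain ⟨N, hN⟩ := ((ENNReal.tendsto_sum_nat_add _ hsum).eventually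
    (gt_mem_nhds zero_lt_one)).exists
  set E₁ : Set Ω := ⋂ k, (gapSet X S 1 (k + N + 1))ᶜ with hE₁
  set E₀ : Set Ω := ⋂ m ∈ Finset.range N, {ω | S 0 0 m ω = 1} with hE₀
  have hE₁pos : P E₁ ≠ 0 := by
    intro h0
    have h1 : P (⋃ k, gapSet X S 1 (k + N + 1)) = 1 := by
      have := (prob_compl_eq_zero_iff (MeasurableSet.iUnion fun k =>
        h.measurableSet_gapSet (X := X) (S := S) 1 (k + N + 1))).1 (by
          rw [Set.compl_iUnion]; exact h0)
      exact this
    have h2 := measure_iUnion_le (μ := P) fun k => gapSet X S 1 (k + N + 1)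
    rw [h1] at h2
    exact absurd hN (not_lt.2 h2)
  have hE₀pos : P E₀ ≠ 0 := by
    have h1 : P E₀ = ∏ m ∈ Finset.range N, P {ω | S 0 0 m ω = 1} :=
      (h.iIndepFun_steps 0 0).meas_biInter fun m _ => ⟨{1}, measurableSet_singleton _, rfl⟩
    rw [h1]
    refine Finset.prod_ne_zero_iff.2 fun m _ => ?_
    rw [h.step_right, ne_eq, ENNReal.ofReal_eq_zero, not_le]
    linarith [h.lt_one 0]
  have hpos : P (E₀ ∩ E₁) ≠ 0 := by
    have hI := h.indep_siteSpace (A := {0}) (B := Set.Ici 1) (by simp)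
    rw [(Indep_iff _ _ P).1 hI E₀ E₁]
    · exact mul_ne_zero hE₀pos hE₁pos
    · exact Finset.measurableSet_biInter _ fun m _ =>
        measurable_step_siteSpace (X := X) (S := S) (A := {0}) rfl 0 m (measurableSet_singleton 1)
    · exact MeasurableSet.iInter fun k => MeasurableSet.compl
        (siteSpace_mono Set.Ico_subset_Ici_self _ (measurableSet_gapSet_siteSpace 1 _))
  intro htr
  refine hpos (measure_mono_null_ae ?_ htr)
  filter_upwards [h.ae_steps, h.ae_visit_zero, h.ae_infinite_nonempty] with ω h1 h2 h3 hω
  refine infinite_frogsHittingOrigin h1 (fun n hn hgap => ?_) h3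
    fun j i => exists_position_eq_zero h1 (h2 j i)
  rcases le_or_gt n N with hnN | hnN
  · refine hgap 0 le_rfl hn 0 (by simp [frogCount]) ⟨n, ?_⟩
    have : ∀ m ∈ Finset.range n, S 0 0 m ω = 1 := fun m hm => by
      have := Set.mem_iInter₂.1 hω.1 m (by rw [Finset.mem_range] at hm ⊢; omega)
      exact this
    rw [position, Finset.sum_congr rfl this]
    simp
  · have := Set.mem_iInter.1 hω.2 (n - N - 1)
    rw [show n - N - 1 + N + 1 = n by omega] at this
    exact this fun j hj hjn => hgap j (Nat.zero_le _) hjn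

/-- The model is transient if and only if the expected number of gaps is infinite. -/
lemma IsNonhomogeneous.transient_iff :
    Transient P X S ↔ ∑' N, P (gapSet X S 1 (N + 1)) = ⊤ :=
  ⟨fun ht => by_contra fun hs => h.not_transient_of_tsum_ne_top hs ht,
    h.transient_of_tsum_eq_top hident⟩

end

end Criterion

/-! ### Riemann sums of monotone and convex functions on a half-line. -/

section RiemannSums

open Set

/-- The midpoint inequality for convex functions. -/
lemma mul_le_integral_of_convexOn {f : ℝ → ℝ} {a b : ℝ} (hab : a ≤ b) (hf : ConvexOn ℝ (Icc a b) f)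
    (hi : IntervalIntegrable f volume a b) : (b - a) * f ((a + b) / 2) ≤ ∫ x in a..b, f x := by
  have hr : ∫ x in a..b, f (a + b - x) = ∫ x in a..b, f x := by
    rw [intervalIntegral.integral_comp_sub_left]; simp
  have hi' : IntervalIntegrable (fun x => f (a + b - x)) volume a b := by
    have := (hi.comp_sub_left (a + b)).symm
    simpa using this
  have h1 : ∫ x in a..b, 2 * f ((a + b) / 2) ≤ ∫ x in a..b, (f x + f (a + b - x)) := by
    refine intervalIntegral.integral_mono_on hab (by simp) (hi.add hi') fun x hx => ?_
    have h2 := hf.2 hx (show a + b - x ∈ Icc a b from ⟨by linarith [hx.2], by linarith [hx.1]⟩)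
      (show (0 : ℝ) ≤ 1 / 2 by norm_num) (show (0 : ℝ) ≤ 1 / 2 by norm_num) (by norm_num)
    simp only [smul_eq_mul] at h2
    rw [show (1 / 2 : ℝ) * x + 1 / 2 * (a + b - x) = (a + b) / 2 by ring] at h2
    linarith
  rw [intervalIntegral.integral_add hi hi', hr, intervalIntegral.integral_const, smul_eq_mul] at h1
  linarith

/-- The trapezoid inequality for convex functions. -/
lemma integral_le_mul_of_convexOn {f : ℝ → ℝ} {a b : ℝ} (hab : a ≤ b) (hf : ConvexOn ℝ (Icc a b) f)
    (hi : IntervalIntegrable f volume a b) : ∫ x in a..b, f x ≤ (b - a) * ((f a + f b) / 2) := by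
  rcases hab.eq_or_lt with rfl | hlt
  · simp
  have hr : ∫ x in a..b, f (a + b - x) = ∫ x in a..b, f x := by
    rw [intervalIntegral.integral_comp_sub_left]; simp
  have hi' : IntervalIntegrable (fun x => f (a + b - x)) volume a b := by
    have := (hi.comp_sub_left (a + b)).symm
    simpa using this
  have h1 : ∫ x in a..b, (f x + f (a + b - x)) ≤ ∫ x in a..b, (f a + f b) := by
    refine intervalIntegral.integral_mono_on hab (hi.add hi') (by simp) fun x hx => ?_
    have hba : 0 < b - a := sub_pos.2 hlt
    have ht0 : 0 ≤ (x - a) / (b - a) := div_nonneg (by linarith [hx.1]) hba.le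
    have ht1 : 0 ≤ (b - x) / (b - a) := div_nonneg (by linarith [hx.2]) hba.le
    have ht : (b - x) / (b - a) + (x - a) / (b - a) = 1 := by field_simp; ring
    have ha : a ∈ Icc a b := left_mem_Icc.2 hab
    have hb : b ∈ Icc a b := right_mem_Icc.2 hab
    have h2 := hf.2 ha hb ht1 ht0 ht
    have h3 := hf.2 ha hb ht0 ht1 (by rw [add_comm]; exact ht)
    simp only [smul_eq_mul] at h2 h3
    rw [show (b - x) / (b - a) * a + (x - a) / (b - a) * b = x by field_simp; ring] at h2
    rw [show (x - a) / (b - a) * a + (b - x) / (b - a) * b = a + b - x by field_simp; ring] at h3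
    have h4 : (b - x) / (b - a) * f a + (x - a) / (b - a) * f b +
        ((x - a) / (b - a) * f a + (b - x) / (b - a) * f b) = f a + f b := by
      rw [show (b - x) / (b - a) = 1 - (x - a) / (b - a) by linarith]; ring
    linarith
  rw [intervalIntegral.integral_add hi hi', hr, intervalIntegral.integral_const, smul_eq_mul] at h1
  linarith

lemma intervalIntegrable_of_integrableOn_Ioi {f : ℝ → ℝ} (hf : IntegrableOn f (Ioi 0)) {a b : ℝ}
    (ha : 0 ≤ a) (hb : 0 ≤ b) : IntervalIntegrable f volume a b := by
  rw [intervalIntegrable_iff]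
  exact hf.mono_set fun x hx => (le_min ha hb).trans_lt hx.1

/-- Splitting an integral over a half-line. -/
lemma integral_Ioi_eq_add_add {f : ℝ → ℝ} (hf : IntegrableOn f (Ioi 0)) {a b : ℝ}
    (ha : 0 ≤ a) (hb : 0 ≤ b) : ∫ x in Ioi 0, f x =
      (∫ x in 0..a, f x) + (∫ x in a..b, f x) + ∫ x in Ioi b, f x := by
  have hsub : ∀ {c : ℝ}, 0 ≤ c → IntegrableOn f (Ioi c) := fun hc =>
    hf.mono_set (Ioi_subset_Ioi hc)
  rw [← intervalIntegral.integral_interval_add_Ioi hf (hsub ha),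
    ← intervalIntegral.integral_interval_add_Ioi (hsub ha) (hsub hb), add_assoc]

variable {f : ℝ → ℝ} (hf : IntegrableOn f (Ioi 0)) {h : ℝ} (hh : 0 < h)

include hf hh

lemma sum_integral_cells {c : ℝ} (hc : 0 ≤ c) (N : ℕ) :
    ∑ k ∈ Finset.range N, ∫ x in (c + h * k)..(c + h * (k + 1)), f x =
      ∫ x in c..(c + h * N), f x := by
  have := intervalIntegral.sum_integral_adjacent_intervals (f := f) (μ := volume)
    (a := fun k : ℕ => c + h * k) (n := N) (fun k _ =>
      intervalIntegrable_of_integrableOn_Ioi hf (by positivity) (by positivity))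
  simpa using this

omit hh in
lemma integral_le_of_nonneg (hf0 : ∀ x, 0 < x → 0 ≤ f x) {a b : ℝ} (ha : 0 ≤ a) (hab : a ≤ b) :
    (∫ x in 0..a, f x) + ∫ x in a..b, f x ≤ ∫ x in Ioi 0, f x := by
  rw [integral_Ioi_eq_add_add hf ha (ha.trans hab)]
  have : 0 ≤ ∫ x in Ioi b, f x := setIntegral_nonneg measurableSet_Ioi fun x hx =>
    hf0 x ((ha.trans hab).trans_lt hx)
  linarith

lemma sum_le_integral_of_antitoneOn (hf0 : ∀ x, 0 < x → 0 ≤ f x) (hfa : AntitoneOn f (Ioi 0))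
    (N : ℕ) : h * ∑ k ∈ Finset.range N, f (h * (k + 1)) ≤ ∫ x in Ioi 0, f x := by
  have h1 := integral_le_of_nonneg hf hf0 le_rfl (show 0 ≤ 0 + h * N by positivity)
  rw [intervalIntegral.integral_same, zero_add, ← sum_integral_cells hf hh le_rfl] at h1
  refine le_trans ?_ h1
  rw [Finset.mul_sum]
  refine Finset.sum_le_sum fun k _ => ?_
  have h2 : ∫ x in (0 + h * k)..(0 + h * (k + 1)), f (h * (k + 1)) ≤
      ∫ x in (0 + h * k)..(0 + h * (k + 1)), f x := by
    refine intervalIntegral.integral_mono_on_of_le_Ioo (by nlinarith) (by simp)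
      (intervalIntegrable_of_integrableOn_Ioi hf (by positivity) (by positivity)) fun x hx => ?_
    have hx0 : 0 < x := lt_of_le_of_lt (by positivity) hx.1
    exact hfa hx0 (show 0 < h * ((k : ℝ) + 1) by positivity) (by linarith [hx.2])
  rw [intervalIntegral.integral_const, smul_eq_mul] at h2
  calc _ = (0 + h * ((k : ℝ) + 1) - (0 + h * k)) * f (h * (k + 1)) := by ring
    _ ≤ _ := h2

/-- Each sample dominates the cell to its right; the uncovered first cell `(0, h)` is paid for by `h
* C`. -/
lemma integral_le_sum_of_antitoneOn (hf0 : ∀ x, 0 < x → 0 ≤ f x) (hfa : AntitoneOn f (Ioi 0))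
    {C : ℝ} (hC : ∀ x, 0 < x → f x ≤ C) (N : ℕ) : (∫ x in Ioi 0, f x) - h * C -
      ∫ x in Ioi (h * N), f x ≤ h * ∑ k ∈ Finset.range N, f (h * (k + 1)) := by
  have h1 := integral_Ioi_eq_add_add hf hh.le (show 0 ≤ h + h * N by positivity)
  have h2 : ∫ x in 0..h, f x ≤ ∫ x in 0..h, C :=
    intervalIntegral.integral_mono_on_of_le_Ioo hh.le
      (intervalIntegrable_of_integrableOn_Ioi hf le_rfl hh.le) (by simp) fun x hx => hC x hx.1
  rw [intervalIntegral.integral_const, smul_eq_mul, sub_zero] at h2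
  have h3 : ∫ x in Ioi (h + h * N), f x ≤ ∫ x in Ioi (h * N), f x := by
    refine setIntegral_mono_set (hf.mono_set (Ioi_subset_Ioi (by positivity))) ?_
      (Ioi_subset_Ioi (by linarith)).eventuallyLE
    refine (ae_restrict_mem measurableSet_Ioi).mono fun x hx => hf0 x ?_
    exact lt_of_le_of_lt (by positivity) hx
  have h4 : ∫ x in h..(h + h * N), f x ≤ h * ∑ k ∈ Finset.range N, f (h * (k + 1)) := by
    rw [← sum_integral_cells hf hh hh.le, Finset.mul_sum]
    refine Finset.sum_le_sum fun k _ => ?_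
    have h2 : ∫ x in (h + h * k)..(h + h * (k + 1)), f x ≤
        ∫ x in (h + h * k)..(h + h * (k + 1)), f (h * (k + 1)) := by
      refine intervalIntegral.integral_mono_on_of_le_Ioo (by nlinarith)
        (intervalIntegrable_of_integrableOn_Ioi hf (by positivity) (by positivity)) (by simp)
        fun x hx => ?_
      have hk0 : 0 < h * ((k : ℝ) + 1) := by positivity
      have hx1 : h * ((k : ℝ) + 1) ≤ x := by linarith [hx.1]
      exact hfa hk0 (hk0.trans_le hx1) hx1
    rw [intervalIntegral.integral_const, smul_eq_mul] at h2
    calc _ ≤ _ := h2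
      _ = _ := by ring
  linarith

/-- Cells are centred at the sample points, so the midpoint inequality applies. The leftover `(0, h
/ 2)` contributes the term `h / 2 * f (h / 2)`, the source of the logarithmic correction. -/
lemma sum_le_integral_of_convexOn (hf0 : ∀ x, 0 < x → 0 ≤ f x) (hfa : AntitoneOn f (Ioi 0))
    (hfc : ConvexOn ℝ (Ioi 0) f) (N : ℕ) : h * ∑ k ∈ Finset.range N, f (h * (k + 1)) ≤
      (∫ x in Ioi 0, f x) - h / 2 * f (h / 2) := by
  have hh2 : 0 < h / 2 := by positivity
  have h1 := integral_le_of_nonneg hf hf0 hh2.le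
    (show h / 2 ≤ h / 2 + h * N by have : 0 ≤ h * N := by positivity
                                   linarith)
  rw [← sum_integral_cells hf hh hh2.le] at h1
  have h2 : ∫ x in 0..(h / 2), f (h / 2) ≤ ∫ x in 0..(h / 2), f x :=
    intervalIntegral.integral_mono_on_of_le_Ioo hh2.le (by simp)
      (intervalIntegrable_of_integrableOn_Ioi hf le_rfl hh2.le) fun x hx =>
        hfa hx.1 hh2 hx.2.le
  rw [intervalIntegral.integral_const, smul_eq_mul, sub_zero] at h2
  have h3 : h * ∑ k ∈ Finset.range N, f (h * (k + 1)) ≤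
      ∑ k ∈ Finset.range N, ∫ x in (h / 2 + h * k)..(h / 2 + h * (k + 1)), f x := by
    rw [Finset.mul_sum]
    refine Finset.sum_le_sum fun k _ => ?_
    have hc0 : 0 < h / 2 + h * k := by positivity
    have := mul_le_integral_of_convexOn (f := f) (a := h / 2 + h * k) (b := h / 2 + h * (k + 1))
      (by nlinarith) (hfc.subset (fun x hx => hc0.trans_le hx.1) (convex_Icc _ _))
      (intervalIntegrable_of_integrableOn_Ioi hf (by positivity) (by positivity))
    calc _ = (h / 2 + h * ((k : ℝ) + 1) - (h / 2 + h * k)) *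
          f ((h / 2 + h * k + (h / 2 + h * (k + 1))) / 2) := by
          congr 1
          · ring
          · congr 1; ring
      _ ≤ _ := this
  linarith

/-- The trapezoid inequality between consecutive samples gives the end sample `f h` weight `h / 2`
only; the unused half supplies the logarithmic correction from below. -/
lemma integral_le_sum_of_convexOn (hf0 : ∀ x, 0 < x → 0 ≤ f x)
    (hfc : ConvexOn ℝ (Ioi 0) f) (N : ℕ) :
    (∫ x in Ioi 0, f x) - (∫ x in 0..h, f x) + h / 2 * f h - ∫ x in Ioi (h * (N + 1)), f x ≤
      h * ∑ k ∈ Finset.range (N + 1), f (h * (k + 1)) := by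
  have h1 := integral_Ioi_eq_add_add hf hh.le (show 0 ≤ h + h * N by positivity)
  rw [← sum_integral_cells hf hh hh.le] at h1
  have h2 : ∑ k ∈ Finset.range N, ∫ x in (h + h * k)..(h + h * (k + 1)), f x ≤
      ∑ k ∈ Finset.range N, (h / 2 * f (h * (k + 1)) + h / 2 * f (h * ((k + 1 : ℕ) + 1))) := by
    refine Finset.sum_le_sum fun k _ => ?_
    have hc0 : 0 < h + h * k := by positivity
    have := integral_le_mul_of_convexOn (f := f) (a := h + h * k) (b := h + h * (k + 1))
      (by nlinarith) (hfc.subset (fun x hx => hc0.trans_le hx.1) (convex_Icc _ _))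
      (intervalIntegrable_of_integrableOn_Ioi hf (by positivity) (by positivity))
    rw [show h * ((k : ℝ) + 1) = h + h * k by ring,
      show h * (((k + 1 : ℕ) : ℝ) + 1) = h + (h + h * k) by push_cast; ring]
    rw [show h + h * ((k : ℝ) + 1) = h + (h + h * k) by ring] at this
    calc _ ≤ _ := this
      _ = _ := by ring
  rw [Finset.sum_add_distrib, ← Finset.mul_sum, ← Finset.mul_sum] at h2
  have h3 := Finset.sum_range_succ (fun k : ℕ => f (h * (k + 1))) N
  have h4 := Finset.sum_range_succ' (fun k : ℕ => f (h * (k + 1))) N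
  simp only [Nat.cast_zero, zero_add, mul_one] at h4
  have h5 : 0 ≤ f (h * ((N : ℝ) + 1)) := hf0 _ (by positivity)
  have h6 : h * ((N : ℝ) + 1) = h + h * N := by ring
  rw [h6]
  rw [h6] at h5
  have h7 : h * ∑ k ∈ Finset.range (N + 1), f (h * (k + 1)) =
      h / 2 * ∑ k ∈ Finset.range N, f (h * (k + 1)) + h / 2 * f (h * (N + 1)) +
      (h / 2 * ∑ k ∈ Finset.range N, f (h * ((k + 1 : ℕ) + 1)) + h / 2 * f h) := by
    rw [← mul_add, ← mul_add, ← h3, ← h4]; ring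
  rw [h7, h6]
  have h8 : 0 ≤ h / 2 * f (h + h * N) := mul_nonneg (by positivity) h5
  linarith

end RiemannSums

/-! ### The singular function -log(1 - e^{-x}). -/

section LogGap

open Set

/-- The function `x ↦ -log (1 - e^{-x})`. -/
noncomputable def logGap (x : ℝ) : ℝ := -Real.log (1 - Real.exp (-x))

lemma one_sub_exp_neg_pos {x : ℝ} (hx : 0 < x) : 0 < 1 - Real.exp (-x) :=
  sub_pos.2 (Real.exp_lt_one_iff.2 (by linarith))

lemma one_sub_exp_neg_lt_one (x : ℝ) : 1 - Real.exp (-x) < 1 := by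
  linarith [Real.exp_pos (-x)]

lemma exp_sub_one_pos {x : ℝ} (hx : 0 < x) : 0 < Real.exp x - 1 := by
  linarith [Real.add_one_lt_exp hx.ne']

lemma exp_neg_div_one_sub {x : ℝ} :
    Real.exp (-x) / (1 - Real.exp (-x)) = 1 / (Real.exp x - 1) := by
  have := Real.exp_pos x
  rw [Real.exp_neg]
  rcases eq_or_ne (Real.exp x) 1 with h | h
  · simp [h]
  have h1 : Real.exp x - 1 ≠ 0 := sub_ne_zero.2 h
  have h2 : 1 - (Real.exp x)⁻¹ ≠ 0 := by
    rw [show 1 - (Real.exp x)⁻¹ = (Real.exp x - 1) / Real.exp x by field_simp]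
    exact div_ne_zero h1 this.ne'
  field_simp

lemma logGap_nonneg {x : ℝ} (hx : 0 < x) : 0 ≤ logGap x :=
  neg_nonneg.2 (Real.log_nonpos (one_sub_exp_neg_pos hx).le (one_sub_exp_neg_lt_one x).le)

lemma logGap_antitoneOn : AntitoneOn logGap (Ioi 0) := by
  intro x hx y _ hxy
  refine neg_le_neg (Real.log_le_log (one_sub_exp_neg_pos hx) ?_)
  have := Real.exp_le_exp.2 (neg_le_neg hxy)
  linarith

/-- The logarithm is increasing and concave, and `1 - e^{-x}` is concave, so their composition is
concave. -/
lemma logGap_convexOn : ConvexOn ℝ (Ioi 0) logGap := by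
  refine ⟨convex_Ioi 0, fun x hx y hy a b ha hb hab => ?_⟩
  have h1 := convexOn_exp.2 (mem_univ (-x)) (mem_univ (-y)) ha hb hab
  have h2 := strictConcaveOn_log_Ioi.concaveOn.2 (one_sub_exp_neg_pos hx)
    (one_sub_exp_neg_pos hy) ha hb hab
  simp only [smul_eq_mul, logGap] at h1 h2 ⊢
  have hpos : 0 < a * (1 - Real.exp (-x)) + b * (1 - Real.exp (-y)) :=
    (convex_Ioi (0 : ℝ)) (one_sub_exp_neg_pos hx) (one_sub_exp_neg_pos hy) ha hb hab
  have h3 : Real.log (a * (1 - Real.exp (-x)) + b * (1 - Real.exp (-y))) ≤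
      Real.log (1 - Real.exp (-(a * x + b * y))) := by
    refine Real.log_le_log hpos ?_
    rw [show -(a * x + b * y) = a * -x + b * -y by ring]
    linarith
  linarith

lemma neg_log_le_logGap {x : ℝ} (hx : 0 < x) : -Real.log x ≤ logGap x := by
  refine neg_le_neg (Real.log_le_log (one_sub_exp_neg_pos hx) ?_)
  linarith [Real.add_one_le_exp (-x)]

/-- From `x * e^{-x} ≤ 1 - e^{-x}`; with `neg_log_le_logGap` this pins down the singularity at `0`
up to `x`. -/
lemma logGap_le {x : ℝ} (hx : 0 < x) : logGap x ≤ x - Real.log x := by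
  have h1 : x * Real.exp (-x) ≤ 1 - Real.exp (-x) := by
    have h2 : (x + 1) * Real.exp (-x) ≤ Real.exp x * Real.exp (-x) :=
      mul_le_mul_of_nonneg_right (Real.add_one_le_exp x) (Real.exp_pos _).le
    rw [← Real.exp_add, add_neg_cancel, Real.exp_zero] at h2
    linarith
  have h2 := Real.log_le_log (by positivity) h1
  rw [Real.log_mul hx.ne' (Real.exp_pos _).ne', Real.log_exp] at h2
  rw [logGap]
  linarith

/-- The slope of `logGap` between `x` and `y` is at most `1 / (e^x - 1)` in absolute value. -/
lemma logGap_sub_le {x y : ℝ} (hx : 0 < x) (hxy : x ≤ y) :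
    logGap x - logGap y ≤ (Real.exp (-x) - Real.exp (-y)) / (1 - Real.exp (-x)) := by
  have h1 := one_sub_exp_neg_pos hx
  have h2 := one_sub_exp_neg_pos (hx.trans_le hxy)
  have h3 := Real.log_le_sub_one_of_pos (div_pos h2 h1)
  rw [Real.log_div h2.ne' h1.ne'] at h3
  rw [logGap, logGap]
  calc _ = Real.log (1 - Real.exp (-y)) - Real.log (1 - Real.exp (-x)) := by ring
    _ ≤ _ := h3
    _ = _ := by field_simp; ring

lemma exp_neg_sub_le (x y : ℝ) :
    Real.exp (-x) - Real.exp (-y) ≤ (y - x) * Real.exp (-x) := by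
  have h1 : (x - y + 1) * Real.exp (-x) ≤ Real.exp (x - y) * Real.exp (-x) :=
    mul_le_mul_of_nonneg_right (Real.add_one_le_exp _) (Real.exp_pos _).le
  rw [← Real.exp_add, show x - y + -x = -y by ring] at h1
  linarith

lemma logGap_le_div {x : ℝ} (hx : 0 < x) : logGap x ≤ 1 / (Real.exp x - 1) := by
  have h1 := one_sub_exp_neg_pos hx
  have h3 := Real.one_sub_inv_le_log_of_pos h1
  rw [← exp_neg_div_one_sub, logGap]
  have : Real.exp (-x) / (1 - Real.exp (-x)) = (1 - Real.exp (-x))⁻¹ - 1 := by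
    field_simp; ring
  linarith

lemma one_div_exp_sub_one_le {x : ℝ} (hx : 0 < x) : 1 / (Real.exp x - 1) ≤ 2 / x ^ 2 := by
  rw [div_le_div_iff₀ (exp_sub_one_pos hx) (by positivity)]
  nlinarith [Real.quadratic_le_exp_of_nonneg hx.le]

lemma integrableOn_inv_sq {b : ℝ} (hb : 0 < b) :
    IntegrableOn (fun x : ℝ => 2 / x ^ 2) (Ioi b) := by
  have := (integrableOn_Ioi_rpow_of_lt (a := -2) (by norm_num) hb).const_mul 2
  refine IntegrableOn.congr_fun this (fun x hx => ?_) measurableSet_Ioi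
  have hx0 : 0 < x := hb.trans hx
  rw [Real.rpow_neg hx0.le, Real.rpow_two, div_eq_mul_inv]

lemma integral_inv_sq {b : ℝ} (hb : 0 < b) : ∫ x in Ioi b, 2 / x ^ 2 = 2 / b := by
  have := integral_Ioi_rpow_of_lt (a := -2) (by norm_num) hb
  have h2 : ∫ x in Ioi b, 2 / x ^ 2 = ∫ x in Ioi b, 2 * x ^ (-2 : ℝ) := by
    refine setIntegral_congr_fun measurableSet_Ioi fun x hx => ?_
    have hx0 : 0 < x := hb.trans hx
    rw [Real.rpow_neg hx0.le, Real.rpow_two, div_eq_mul_inv]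
  rw [h2, integral_const_mul, this]
  norm_num
  rw [Real.rpow_neg_one, div_eq_mul_inv]

/-- A function on `(0, ∞)` that is dominated by `C / (e^x - 1)` has small tails. -/
lemma integral_Ioi_le_of_le {f : ℝ → ℝ} (hf : IntegrableOn f (Ioi 0)) {C : ℝ} (hC : 0 ≤ C)
    (hle : ∀ x, 0 < x → f x ≤ C / (Real.exp x - 1)) {b : ℝ} (hb : 0 < b) :
    ∫ x in Ioi b, f x ≤ 2 * C / b := by
  calc ∫ x in Ioi b, f x ≤ ∫ x in Ioi b, C * (2 / x ^ 2) := by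
        refine setIntegral_mono_on (hf.mono_set (Ioi_subset_Ioi hb.le))
          ((integrableOn_inv_sq hb).const_mul C) measurableSet_Ioi fun x hx => ?_
        have hx0 : 0 < x := hb.trans hx
        refine (hle x hx0).trans ?_
        rw [div_eq_mul_one_div]
        exact mul_le_mul_of_nonneg_left (one_div_exp_sub_one_le hx0) hC
    _ = 2 * C / b := by rw [integral_const_mul, integral_inv_sq hb]; ring

/-- The logarithmic bound controls `(0, 1]`, and `C / (e^x - 1) ≤ 2 * C / x ^ 2` controls the tail.
-/
lemma integrableOn_of_le {f : ℝ → ℝ} (hfa : AntitoneOn f (Ioi 0)) (hf0 : ∀ x, 0 < x → 0 ≤ f x)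
    {C : ℝ} (hC : 0 ≤ C) (h0 : ∀ x, 0 < x → f x ≤ C * (x + 1 - Real.log x))
    (hle : ∀ x, 0 < x → f x ≤ C / (Real.exp x - 1)) : IntegrableOn f (Ioi 0) := by
  have hmeas : AEMeasurable f (volume.restrict (Ioi 0)) :=
    aemeasurable_restrict_of_antitoneOn measurableSet_Ioi hfa
  rw [← Ioc_union_Ioi_eq_Ioi (zero_le_one : (0 : ℝ) ≤ 1)]
  refine IntegrableOn.union ?_ ?_
  · have hi : IntegrableOn (fun x : ℝ => C * (x + 1 - Real.log x)) (Ioc 0 1) := by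
      rw [← intervalIntegrable_iff_integrableOn_Ioc_of_le zero_le_one]
      exact ((intervalIntegral.intervalIntegrable_id.add
        intervalIntegrable_const).sub intervalIntegral.intervalIntegrable_log').const_mul C
    refine Integrable.mono' hi
      (hmeas.mono_measure (Measure.restrict_mono Ioc_subset_Ioi_self le_rfl)).aestronglyMeasurable
      ((ae_restrict_mem measurableSet_Ioc).mono fun x hx => ?_)
    rw [Real.norm_of_nonneg (hf0 x hx.1)]
    exact h0 x hx.1
  · have hi := (integrableOn_inv_sq zero_lt_one).const_mul C
    refine Integrable.mono' hi (hmeas.mono_measure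
      (Measure.restrict_mono (Ioi_subset_Ioi zero_le_one) le_rfl)).aestronglyMeasurable
      ((ae_restrict_mem measurableSet_Ioi).mono fun x hx => ?_)
    have hx0 : 0 < x := zero_lt_one.trans hx
    rw [Real.norm_of_nonneg (hf0 x hx0)]
    refine (hle x hx0).trans ?_
    rw [div_eq_mul_one_div]
    exact mul_le_mul_of_nonneg_left (one_div_exp_sub_one_le hx0) hC

lemma integrableOn_logGap : IntegrableOn logGap (Ioi 0) :=
  integrableOn_of_le logGap_antitoneOn (fun _ => logGap_nonneg) zero_le_one
    (fun x hx => by linarith [logGap_le hx]) (fun x hx => logGap_le_div hx)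

lemma integral_logGap_le {h : ℝ} (hh : 0 < h) :
    ∫ x in 0..h, logGap x ≤ h * (1 + h / 2 - Real.log h) := by
  calc ∫ x in 0..h, logGap x ≤ ∫ x in 0..h, (x - Real.log x) :=
        intervalIntegral.integral_mono_on_of_le_Ioo hh.le
          (intervalIntegrable_of_integrableOn_Ioi integrableOn_logGap le_rfl hh.le)
          (intervalIntegral.intervalIntegrable_id.sub intervalIntegral.intervalIntegrable_log')
          fun x hx => logGap_le hx.1
    _ = h * (1 + h / 2 - Real.log h) := by
        rw [intervalIntegral.integral_sub intervalIntegral.intervalIntegrable_id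
          intervalIntegral.intervalIntegrable_log', integral_log, integral_id]
        ring

end LogGap

/-! ### Riemann sum asymptotics with a logarithmic singularity. -/

section Profile

open Set

/-- The estimates on `F x = -log f (1 - e^{-x})` that are needed for the asymptotics of
`∑ F (h k)` as `h → 0`. -/
structure IsProfile (F : ℝ → ℝ) (d : ℕ) (C : ℝ) : Prop where
  const_nonneg : 0 ≤ C
  integrableOn : IntegrableOn F (Ioi 0)
  nonneg : ∀ x, 0 < x → 0 ≤ F x
  antitoneOn : AntitoneOn F (Ioi 0)
  sub_le : ∀ x y, 0 < x → x ≤ y → F x - F y ≤ C * ((y - x) / (Real.exp x - 1))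
  sum_le : ∀ h, 0 < h → ∀ N : ℕ, ∑ k ∈ Finset.range N, F (h * (k + 1)) ≤
    (∫ x in Ioi 0, F x) / h + d / 2 * Real.log h + C
  le_sum : ∀ h, 0 < h → ∀ N : ℕ, (∫ x in Ioi 0, F x) / h + d / 2 * Real.log h
    - C * (1 + h) - C / ((N + 1) * h ^ 2) ≤ ∑ k ∈ Finset.range (N + 1), F (h * (k + 1))

/-- The sharp convex estimates are needed only for `d * logGap`, which produces `d / 2 * log h`; for
the bounded part `G`, monotonicity already gives an error `O(1)`. -/
lemma exists_isProfile {F G : ℝ → ℝ} {d : ℕ} {A B : ℝ} (hA : 0 ≤ A) (hB : 0 ≤ B)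
    (hF : ∀ x, 0 < x → F x = d * logGap x + G x) (hG0 : ∀ x, 0 < x → 0 ≤ G x)
    (hGA : ∀ x, 0 < x → G x ≤ A) (hGa : AntitoneOn G (Ioi 0))
    (hGB : ∀ x, 0 < x → G x ≤ B * Real.exp (-x))
    (hGl : ∀ x y, 0 < x → x ≤ y → G x - G y ≤ B * (Real.exp (-x) - Real.exp (-y))) :
    ∃ C, IsProfile F d C := by
  have hexp : ∀ x : ℝ, 0 < x → Real.exp (-x) ≤ 1 / (Real.exp x - 1) := by
    intro x hx
    rw [← exp_neg_div_one_sub, le_div_iff₀ (one_sub_exp_neg_pos hx)]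
    exact mul_le_of_le_one_right (Real.exp_pos _).le (one_sub_exp_neg_lt_one x).le
  have hGB' : ∀ x, 0 < x → G x ≤ B / (Real.exp x - 1) := by
    intro x hx
    rw [div_eq_mul_one_div]
    exact (hGB x hx).trans (mul_le_mul_of_nonneg_left (hexp x hx) hB)
  have hGi : IntegrableOn G (Ioi 0) := by
    refine integrableOn_of_le hGa hG0 (C := max A B) (le_max_of_le_left hA) (fun x hx => ?_)
      (fun x hx => ?_)
    · refine (hGA x hx).trans ((le_max_left A B).trans ?_)
      refine le_mul_of_one_le_right (le_max_of_le_left hA) ?_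
      linarith [Real.log_le_sub_one_of_pos hx]
    · refine (hGB' x hx).trans ?_
      exact div_le_div_of_nonneg_right (le_max_right A B) (exp_sub_one_pos hx).le
  have hFi : IntegrableOn F (Ioi 0) :=
    IntegrableOn.congr_fun ((integrableOn_logGap.const_mul (d : ℝ)).add hGi)
      (fun x hx => (hF x hx).symm) measurableSet_Ioi
  have hK : ∫ x in Ioi 0, F x = d * (∫ x in Ioi 0, logGap x) + ∫ x in Ioi 0, G x := by
    rw [setIntegral_congr_fun measurableSet_Ioi (fun x hx => hF x hx),
      integral_add (integrableOn_logGap.const_mul (d : ℝ)) hGi, integral_const_mul]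
  have hsum : ∀ h, 0 < h → ∀ N : ℕ, ∑ k ∈ Finset.range N, F (h * (k + 1)) =
      d * ∑ k ∈ Finset.range N, logGap (h * (k + 1)) +
        ∑ k ∈ Finset.range N, G (h * (k + 1)) := by
    intro h hh N
    rw [Finset.mul_sum, ← Finset.sum_add_distrib]
    exact Finset.sum_congr rfl fun k _ => hF _ (by positivity)
  have hd : (0 : ℝ) ≤ d := Nat.cast_nonneg d
  -- One constant dominates `d + B` (slope), `d * (1 + h / 2) + A` up to the factor `1 + h` (error
  -- near `0`) and `2 * d + 2 * B` (tail).
  set C : ℝ := 2 * d + A + 2 * B with hC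
  have hC0 : 0 ≤ C := by positivity
  refine ⟨C, hC0, hFi, fun x hx => ?_, fun x hx y hy hxy => ?_, fun x y hx hxy => ?_,
    fun h hh N => ?_, fun h hh N => ?_⟩
  · rw [hF x hx]
    exact add_nonneg (mul_nonneg hd (logGap_nonneg hx)) (hG0 x hx)
  · rw [hF x hx, hF y hy]
    exact add_le_add (mul_le_mul_of_nonneg_left (logGap_antitoneOn hx hy hxy) hd) (hGa hx hy hxy)
  · rw [hF x hx, hF y (hx.trans_le hxy)]
    have h0 : 0 ≤ (y - x) / (Real.exp x - 1) :=
      div_nonneg (by linarith) (exp_sub_one_pos hx).le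
    have h1 : logGap x - logGap y ≤ (y - x) / (Real.exp x - 1) := by
      refine (logGap_sub_le hx hxy).trans ?_
      rw [div_eq_mul_one_div (y - x), ← exp_neg_div_one_sub, ← mul_div_assoc]
      exact div_le_div_of_nonneg_right (exp_neg_sub_le x y) (one_sub_exp_neg_pos hx).le
    have h2 : G x - G y ≤ B * ((y - x) / (Real.exp x - 1)) := by
      refine (hGl x y hx hxy).trans (mul_le_mul_of_nonneg_left ?_ hB)
      refine (exp_neg_sub_le x y).trans ?_
      rw [div_eq_mul_one_div (y - x)]
      exact mul_le_mul_of_nonneg_left (hexp x hx) (by linarith)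
    have h3 := mul_le_mul_of_nonneg_left h1 hd
    have h4 : ((d : ℝ) + B) * ((y - x) / (Real.exp x - 1)) ≤ C * ((y - x) / (Real.exp x - 1)) :=
      mul_le_mul_of_nonneg_right (by rw [hC]; linarith) h0
    linarith
  · have h1 := sum_le_integral_of_convexOn integrableOn_logGap hh (fun _ => logGap_nonneg)
      logGap_antitoneOn logGap_convexOn N
    have h2 := sum_le_integral_of_antitoneOn hGi hh hG0 hGa N
    have h3 := neg_log_le_logGap (half_pos hh)
    have h4 : Real.log (h / 2) ≤ Real.log h := Real.log_le_log (by positivity) (by linarith)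
    have h5 : h * ∑ k ∈ Finset.range N, logGap (h * (k + 1)) ≤
        (∫ x in Ioi 0, logGap x) + h / 2 * Real.log h := by
      have : h / 2 * -Real.log h ≤ h / 2 * logGap (h / 2) :=
        mul_le_mul_of_nonneg_left (by linarith) (by positivity)
      linarith
    have h6 : ∑ k ∈ Finset.range N, F (h * (k + 1)) ≤
        (∫ x in Ioi 0, F x) / h + d / 2 * Real.log h := by
      rw [hsum h hh, hK]
      have h7 : ∑ k ∈ Finset.range N, logGap (h * (k + 1)) ≤
          (∫ x in Ioi 0, logGap x) / h + Real.log h / 2 := by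
        rw [mul_comm, ← le_div_iff₀ hh] at h5
        refine h5.trans_eq ?_
        field_simp
      have h8 : ∑ k ∈ Finset.range N, G (h * (k + 1)) ≤ (∫ x in Ioi 0, G x) / h := by
        rwa [le_div_iff₀ hh, mul_comm]
      calc _ ≤ d * ((∫ x in Ioi 0, logGap x) / h + Real.log h / 2) + (∫ x in Ioi 0, G x) / h :=
            add_le_add (mul_le_mul_of_nonneg_left h7 hd) h8
        _ = _ := by ring
    linarith
  · have hb : 0 < h * ((N : ℝ) + 1) := by positivity
    have h1 := integral_le_sum_of_convexOn integrableOn_logGap hh (fun _ => logGap_nonneg)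
      logGap_convexOn N
    have h2 := integral_le_sum_of_antitoneOn hGi hh hG0 hGa hGA (N + 1)
    have h3 := integral_Ioi_le_of_le integrableOn_logGap zero_le_one
      (fun x hx => logGap_le_div hx) hb
    have h4 := integral_Ioi_le_of_le hGi hB hGB' hb
    have h5 := integral_logGap_le hh
    have h6 : h / 2 * -Real.log h ≤ h / 2 * logGap h :=
      mul_le_mul_of_nonneg_left (neg_log_le_logGap hh) (by positivity)
    push_cast at h2
    rw [hsum h hh, hK]
    have h7 : (∫ x in Ioi 0, logGap x) / h + Real.log h / 2 - (1 + h / 2) -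
        2 / ((N + 1) * h ^ 2) ≤ ∑ k ∈ Finset.range (N + 1), logGap (h * (k + 1)) := by
      have : (∫ x in Ioi 0, logGap x) + h * (Real.log h / 2 - (1 + h / 2)) -
          2 * 1 / (h * (N + 1)) ≤ (∑ k ∈ Finset.range (N + 1), logGap (h * (k + 1))) * h := by
        linarith
      rw [← div_le_iff₀ hh] at this
      refine le_trans (le_of_eq ?_) this
      field_simp
      ring
    have h8 : (∫ x in Ioi 0, G x) / h - A - 2 * B / ((N + 1) * h ^ 2) ≤
        ∑ k ∈ Finset.range (N + 1), G (h * (k + 1)) := by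
      have : (∫ x in Ioi 0, G x) - h * A - 2 * B / (h * (N + 1)) ≤
          (∑ k ∈ Finset.range (N + 1), G (h * (k + 1))) * h := by
        linarith
      rw [← div_le_iff₀ hh] at this
      refine le_trans (le_of_eq ?_) this
      field_simp
    have h9 := add_le_add (mul_le_mul_of_nonneg_left h7 hd) h8
    refine le_trans ?_ h9
    have h10 : 0 ≤ A / ((N + 1) * h ^ 2) := by positivity
    have h11 : C / ((N + 1) * h ^ 2) = d * (2 / ((N + 1) * h ^ 2)) + A / ((N + 1) * h ^ 2) +
        2 * B / ((N + 1) * h ^ 2) := by rw [hC]; ring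
    have h12 : d * (1 + h / 2) + A ≤ C * (1 + h) := by
      rw [hC]
      have : 0 ≤ (A + 2 * B) * h + 2 * B + 3 / 2 * d * h + d := by positivity
      linarith
    have h13 : (d * (∫ x in Ioi 0, logGap x) + ∫ x in Ioi 0, G x) / h =
      d * ((∫ x in Ioi 0, logGap x) / h) + (∫ x in Ioi 0, G x) / h := by ring
    rw [h11, h13]
    linarith

end Profile

/-! ### Growth of concave sequences. -/

section ConcaveSequences

lemma ConcaveSeq.increment_le {g : ℕ → ℝ} (hg : ConcaveSeq g) {i j : ℕ} (hi : 1 ≤ i)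
    (hij : i ≤ j) : g (j + 1) - g j ≤ g (i + 1) - g i := by
  induction j, hij using Nat.le_induction with
  | base => exact le_rfl
  | succ j hj ih => linarith [hg j (hi.trans hj)]

/-- The difference on the right is a sum of `j` increments, each at least the later increment on the
left. -/
lemma ConcaveSeq.mul_increment_le {g : ℕ → ℝ} (hg : ConcaveSeq g) {j N : ℕ} (h : j ≤ N) :
    j * (g (N + 2) - g (N + 1)) ≤ g (j + 1) - g 1 := by
  induction j with
  | zero => simp
  | succ j ih =>
    have h1 := ih (by omega)
    have h2 := hg.increment_le (i := j + 1) (j := N + 1) (by omega) (by omega)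
    push_cast
    linarith

/-- A positive concave sequence grows at most linearly. -/
lemma ConcaveSeq.mul_le_mul {g : ℕ → ℝ} (hg : ConcaveSeq g) (h1 : 0 ≤ g 1) {j N : ℕ}
    (h : j ≤ N) : g (N + 1) * j ≤ g (j + 1) * N := by
  induction N, h using Nat.le_induction with
  | base => exact le_rfl
  | succ N hN ih =>
    have := hg.mul_increment_le hN
    push_cast
    linarith

end ConcaveSequences

/-! ### Comparison of the climbing rate with 4a. -/

section Rate

/-- The exponential rate at which the probability to climb decays with the height, for a walk that
steps left with probability `1 / 2 + a`. -/
noncomputable def climbRate (a : ℝ) : ℝ := Real.log (1 + 2 * a) - Real.log (1 - 2 * a)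

lemma climbRate_mono {a b : ℝ} (ha : 0 < a) (hab : a ≤ b) (hb : b < 1 / 2) :
    climbRate a ≤ climbRate b := by
  have h1 := Real.log_le_log (show 0 < 1 + 2 * a by linarith) (show 1 + 2 * a ≤ 1 + 2 * b by linarith)
  have h2 := Real.log_le_log (show 0 < 1 - 2 * b by linarith) (show 1 - 2 * b ≤ 1 - 2 * a by linarith)
  rw [climbRate, climbRate]
  linarith

/-- `4 * a` is the first term of the positive series of `log ((1 + x) / (1 - x))` at `x = 2 * a`. -/
lemma le_climbRate {a : ℝ} (ha : 0 < a) (ha' : a < 1 / 2) : 4 * a ≤ climbRate a := by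
  have h := Real.hasSum_log_sub_log_of_abs_lt_one (x := 2 * a)
    (by rw [abs_of_pos (by linarith)]; linarith)
  have h1 := le_hasSum h 0 fun k _ => by positivity
  simp at h1
  rw [climbRate]
  linarith

/-- Dropping the denominators `2 * k + 1` in the same series leaves a geometric series with sum `4 *
a / (1 - 4 * a ^ 2)`. -/
lemma climbRate_le {a : ℝ} (ha : 0 < a) (ha' : a < 1 / 2) :
    climbRate a ≤ 4 * a * (1 + 4 / (1 - 4 * a ^ 2) * a ^ 2) := by
  have h := Real.hasSum_log_sub_log_of_abs_lt_one (x := 2 * a)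
    (by rw [abs_of_pos (by linarith)]; linarith)
  have hlt : (2 * a) ^ 2 < 1 := by nlinarith
  have hg := (hasSum_geometric_of_lt_one (sq_nonneg (2 * a)) hlt).mul_left (4 * a)
  have h1 := hasSum_le (fun k => ?_) h hg
  · refine h1.trans_eq ?_
    have : 1 - 4 * a ^ 2 ≠ 0 := by nlinarith
    rw [show (2 * a) ^ 2 = 4 * a ^ 2 by ring]
    field_simp
    ring
  · have h2 : (1 : ℝ) / (2 * k + 1) ≤ 1 := by
      rw [div_le_one (by positivity)]
      have : (0 : ℝ) ≤ k := Nat.cast_nonneg k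
      linarith
    calc 2 * (1 / (2 * (k : ℝ) + 1)) * (2 * a) ^ (2 * k + 1)
        ≤ 2 * 1 * (2 * a) ^ (2 * k + 1) := by gcongr
      _ = 4 * a * ((2 * a) ^ 2) ^ k := by rw [pow_succ, pow_mul]; ring

lemma exp_neg_climbRate {a : ℝ} (ha : 0 < a) (ha' : a < 1 / 2) :
    Real.exp (-climbRate a) = (1 - (1 / 2 + a)) / (1 / 2 + a) := by
  rw [climbRate, neg_sub, Real.exp_sub, Real.exp_log (by linarith), Real.exp_log (by linarith)]
  rw [div_eq_div_iff (by linarith) (by linarith)]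
  ring

end Rate

/-! ### Elementary exponential sums. -/

section Sums

lemma sum_exp_le {c : ℝ} (hc : 0 < c) (M : ℕ) :
    ∑ k ∈ Finset.range M, Real.exp (-(c * (k + 1))) ≤ 1 / c := by
  have h : ∑ k ∈ Finset.range M, Real.exp (-(c * (k + 1))) ≤ (1 - Real.exp (-(c * M))) / c := by
    induction M with
    | zero => simp
    | succ M ih =>
      rw [Finset.sum_range_succ]
      have h1 := exp_neg_sub_le (c * (M + 1)) (c * M)
      have h2 : c * Real.exp (-(c * (M + 1))) ≤
          Real.exp (-(c * M)) - Real.exp (-(c * (M + 1))) := by linarith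
      have h3 : Real.exp (-(c * (M + 1))) ≤
          (Real.exp (-(c * M)) - Real.exp (-(c * (M + 1)))) / c := by
        rwa [le_div_iff₀ hc, mul_comm]
      push_cast
      calc _ ≤ (1 - Real.exp (-(c * M))) / c +
            (Real.exp (-(c * M)) - Real.exp (-(c * (M + 1)))) / c := add_le_add ih h3
        _ = _ := by ring
  refine h.trans ?_
  gcongr
  linarith [Real.exp_pos (-(c * M))]

/-- Half of the exponent absorbs the factor `k` at the price `1 / c`; the other half is summed. -/
lemma sum_mul_exp_le {c : ℝ} (hc : 0 < c) (M : ℕ) :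
    ∑ k ∈ Finset.range M, (k : ℝ) * Real.exp (-(2 * c * (k + 1))) ≤ 1 / c ^ 2 := by
  calc ∑ k ∈ Finset.range M, (k : ℝ) * Real.exp (-(2 * c * (k + 1)))
      ≤ ∑ k ∈ Finset.range M, 1 / c * Real.exp (-(c * (k + 1))) := by
        refine Finset.sum_le_sum fun k _ => ?_
        have h1 : (k : ℝ) * Real.exp (-(c * (k + 1))) ≤ 1 / c := by
          have h2 := Real.add_one_le_exp (c * ((k : ℝ) + 1))
          rw [Real.exp_neg, ← div_eq_mul_inv, div_le_div_iff₀ (Real.exp_pos _) hc]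
          nlinarith
        rw [show -(2 * c * ((k : ℝ) + 1)) = -(c * (k + 1)) + -(c * (k + 1)) by ring, Real.exp_add,
          ← mul_assoc]
        exact mul_le_mul_of_nonneg_right h1 (Real.exp_pos _).le
    _ ≤ 1 / c * (1 / c) := by
        rw [← Finset.mul_sum]
        exact mul_le_mul_of_nonneg_left (sum_exp_le hc M) (by positivity)
    _ = 1 / c ^ 2 := by field_simp

/-- Equivalent to `x / 2 ≤ sinh (x / 2)`. -/
lemma div_exp_sub_one_le {x : ℝ} (hx : 0 < x) : x / (Real.exp x - 1) ≤ Real.exp (-(x / 2)) := by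
  rw [div_le_iff₀ (exp_sub_one_pos hx), mul_sub, ← Real.exp_add, mul_one]
  have h1 := Real.self_le_sinh_iff.2 (half_pos hx).le
  rw [Real.sinh_eq] at h1
  rw [show -(x / 2) + x = x / 2 by ring]
  linarith

/-- With `s = Nat.sqrt N`, one has `N ≤ (s + 1) ^ 2`, and the fourth-order term of `exp (c * (s +
1))` gives a bound of order `1 / N ^ 2`; the shift by one costs `exp c`. -/
lemma summable_exp_neg_sqrt {c : ℝ} (hc : 0 < c) :
    Summable fun N : ℕ => Real.exp (-(c * Nat.sqrt N)) := by
  have hs : Summable fun N : ℕ => Real.exp c * 24 / c ^ 4 * (1 / (N : ℝ) ^ 2) :=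
    (Real.summable_one_div_nat_pow.2 one_lt_two).mul_left _
  refine Summable.of_norm_bounded_eventually_nat hs ?_
  filter_upwards [Filter.eventually_ge_atTop 1] with N hN
  rw [Real.norm_of_nonneg (Real.exp_pos _).le]
  set s : ℝ := (Nat.sqrt N : ℝ) with hsdef
  have hs0 : 0 ≤ s := Nat.cast_nonneg _
  have hN0 : (0 : ℝ) < N := by exact_mod_cast hN
  have h1 : (N : ℝ) ≤ (s + 1) ^ 2 := by
    have := (Nat.lt_succ_sqrt' N).le
    calc (N : ℝ) ≤ ((Nat.succ (Nat.sqrt N) ^ 2 : ℕ) : ℝ) := by exact_mod_cast this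
      _ = _ := by push_cast; rfl
  have h2 := Real.pow_div_factorial_le_exp (c * (s + 1)) (by positivity) 4
  have h3 : (N : ℝ) ^ 2 ≤ (s + 1) ^ 4 := by
    calc (N : ℝ) ^ 2 ≤ ((s + 1) ^ 2) ^ 2 := by gcongr
      _ = _ := by ring
  have h4 : c ^ 4 * (N : ℝ) ^ 2 ≤ 24 * Real.exp (c * (s + 1)) := by
    have h5 : c ^ 4 * (N : ℝ) ^ 2 ≤ (c * (s + 1)) ^ 4 := by
      rw [mul_pow]; gcongr
    norm_num [Nat.factorial] at h2
    linarith
  rw [Real.exp_neg]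
  rw [show c * (s + 1) = c + c * s by ring, Real.exp_add] at h4
  have h6 := Real.exp_pos (c * s)
  rw [inv_eq_one_div, div_mul_div_comm, mul_one, div_le_div_iff₀ h6 (by positivity)]
  linarith

end Sums

/-! ### Comparison of the gap energy with the explicit exponent. -/

section Comparison

open Set

/-- A drift sequence: positive, below `1 / 2`, decreasing, with concave reciprocals. -/
structure IsDrift (a : ℕ → ℝ) : Prop where
  pos : ∀ j, 1 ≤ j → 0 < a j
  lt_half : ∀ j, 1 ≤ j → a j < 1 / 2
  anti : ∀ i j, 1 ≤ i → i ≤ j → a j ≤ a i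
  concave : ConcaveSeq fun j => 1 / a j

/-- The energy `∑ F (h k)` where the rate `h` varies with the distance `k`. -/
noncomputable def gapEnergy (F : ℝ → ℝ) (a : ℕ → ℝ) (N : ℕ) : ℝ :=
  ∑ k ∈ Finset.range N, F (climbRate (a (N - k)) * (k + 1))

variable {a : ℕ → ℝ}

lemma IsDrift.climbRate_pos (ha : IsDrift a) {j : ℕ} (hj : 1 ≤ j) : 0 < climbRate (a j) := by
  have := le_climbRate (ha.pos j hj) (ha.lt_half j hj)
  linarith [ha.pos j hj]

/-- The constant in the comparison of `climbRate (a j)` with `4 * a j`. -/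
noncomputable def rateConst (a : ℕ → ℝ) : ℝ := 4 / (1 - 4 * a 1 ^ 2)

lemma IsDrift.rateConst_pos (ha : IsDrift a) : 0 < rateConst a := by
  have h1 := ha.pos 1 le_rfl
  have h2 := ha.lt_half 1 le_rfl
  exact div_pos (by norm_num) (by nlinarith)

lemma IsDrift.climbRate_le (ha : IsDrift a) {j : ℕ} (hj : 1 ≤ j) :
    climbRate (a j) ≤ 4 * a j * (1 + rateConst a * a j ^ 2) := by
  have h0 := ha.pos j hj
  have h1 := ha.anti 1 j le_rfl hj
  have h2 := ha.lt_half 1 le_rfl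
  refine (FrogModel.climbRate_le h0 (ha.lt_half j hj)).trans ?_
  have h3 : 4 / (1 - 4 * a j ^ 2) ≤ rateConst a :=
    div_le_div_of_nonneg_left (by norm_num) (by nlinarith) (by nlinarith)
  gcongr

/-- Concavity controls how much larger the drift is at nearby sites to the left. -/
lemma IsDrift.le_mul (ha : IsDrift a) {N k : ℕ} (hk : 2 * k + 1 ≤ N) :
    a (N - k) ≤ a N * (1 + 4 * (k / N)) := by
  obtain ⟨n, rfl⟩ := Nat.exists_eq_add_of_le' (show 1 ≤ N by omega)
  rcases Nat.eq_zero_or_pos k with rfl | hk0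
  · simp
  have h1 := ha.concave.mul_le_mul (one_div_nonneg.2 (ha.pos 1 le_rfl).le)
    (show n - k ≤ n by omega)
  rw [show n - k + 1 = n + 1 - k by omega] at h1
  set x := a (n + 1) with hx
  set y := a (n + 1 - k) with hy
  have hx0 : 0 < x := ha.pos _ (by omega)
  have hy0 : 0 < y := ha.pos _ (by omega)
  rw [Nat.cast_sub (by omega : k ≤ n)] at h1
  rw [div_mul_eq_mul_div, div_mul_eq_mul_div, one_mul, one_mul, div_le_div_iff₀ hx0 hy0] at h1
  have hn : (2 : ℝ) * k ≤ n := by exact_mod_cast (show 2 * k ≤ n by omega)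
  have hk1 : (1 : ℝ) ≤ k := by exact_mod_cast hk0
  have hpos : 0 < (n : ℝ) - k := by linarith
  -- The surplus has numerator `k * (3 * n - 4 * k - 1)`, nonnegative because `n ≥ 2 * k` and `k ≥
  -- 1`; hence the separate case `k = 0`.
  have h2 : (n : ℝ) ≤ (n - k) * (1 + 4 * (k / (n + 1 : ℕ))) := by
    push_cast
    have : (n - k) * (1 + 4 * (k / ((n : ℝ) + 1))) - n = k * (3 * n - 4 * k - 1) / (n + 1) := by
      field_simp
      ring
    have h3 : 0 ≤ k * (3 * n - 4 * k - 1) / ((n : ℝ) + 1) :=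
      div_nonneg (mul_nonneg (by linarith) (by linarith)) (by linarith)
    linarith
  have h4 : y * (n - k) ≤ x * (1 + 4 * (k / (n + 1 : ℕ))) * (n - k) := by
    nlinarith
  exact le_of_mul_le_mul_right h4 hpos

/-- The relative error of the approximation of `climbRate (a (N - k))` by `4 * a N`. -/
lemma IsDrift.climbRate_le_mul (ha : IsDrift a) {N k : ℕ} (hk : 2 * k + 1 ≤ N) :
    climbRate (a (N - k)) ≤
      4 * a N * (1 + (4 + 18 * rateConst a) * (k / N + a N ^ 2)) := by
  have h1 := ha.climbRate_le (j := N - k) (by omega)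
  have h2 := ha.le_mul hk
  have hκ := ha.rateConst_pos
  set κ := rateConst a
  set x := a N
  set y := a (N - k)
  set u : ℝ := k / N with hu
  have hx0 : 0 < x := ha.pos _ (by omega)
  have hx1 : x < 1 / 2 := ha.lt_half _ (by omega)
  have hy0 : 0 < y := ha.pos _ (by omega)
  have hu0 : 0 ≤ u := by positivity
  have hu1 : u ≤ 1 / 2 := by
    rw [hu, div_le_iff₀ (by exact_mod_cast (show 0 < N by omega))]
    have : (2 : ℝ) * k + 1 ≤ N := by exact_mod_cast hk
    linarith
  have h3 : y ≤ 3 * x := by nlinarith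
  have h4 : y ^ 2 ≤ 9 * x ^ 2 := by nlinarith
  have h5 : 4 * y * (1 + κ * y ^ 2) ≤ 4 * (x * (1 + 4 * u)) * (1 + κ * (9 * x ^ 2)) := by
    gcongr
  refine h1.trans (h5.trans ?_)
  rw [mul_assoc 4 x, mul_assoc 4, mul_assoc x]
  refine mul_le_mul_of_nonneg_left (mul_le_mul_of_nonneg_left ?_ hx0.le) (by norm_num)
  -- The cross term `36 * κ * u * x ^ 2` is at most `9 * κ * u` since `x < 1 / 2`.
  have h6 : 0 ≤ κ * u * (1 / 4 - x ^ 2) := mul_nonneg (by positivity) (by nlinarith)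
  have h7 : 0 ≤ κ * u := by positivity
  have h8 : 0 ≤ κ * x ^ 2 := by positivity
  nlinarith [sq_nonneg x]

lemma IsDrift.climbRate_le_const_mul (ha : IsDrift a) {N k : ℕ} (hk : 2 * k + 1 ≤ N) :
    climbRate (a (N - k)) ≤ 4 * (1 + (4 + 18 * rateConst a)) * a N := by
  refine (ha.climbRate_le_mul hk).trans ?_
  have hκ := ha.rateConst_pos
  have hx0 : 0 < a N := ha.pos _ (by omega)
  have hx1 : a N < 1 / 2 := ha.lt_half _ (by omega)
  have hu1 : (k : ℝ) / N ≤ 1 / 2 := by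
    rw [div_le_iff₀ (by exact_mod_cast (show 0 < N by omega))]
    have : (2 : ℝ) * k + 1 ≤ N := by exact_mod_cast hk
    linarith
  have h1 : (k : ℝ) / N + a N ^ 2 ≤ 1 := by nlinarith
  calc _ ≤ 4 * a N * (1 + (4 + 18 * rateConst a) * 1) := by gcongr
    _ = _ := by ring

variable {F : ℝ → ℝ} {d : ℕ} {C : ℝ}

/-- The critical term of the series, in exponential form. -/
lemma exp_neg_div_rpow {K x : ℝ} (hx : 0 < x) : Real.exp (-(K / (4 * x))) / x ^ ((d : ℝ) / 2) =
    Real.exp (-(K / (4 * x) + d / 2 * Real.log x)) := by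
  rw [Real.rpow_def_of_pos hx, ← Real.exp_sub]
  congr 1
  ring

/-- Rates grow with the distance from `N` and `F` is decreasing, so replacing all of them by the
rate at `N` only increases the sum. -/
lemma gapEnergy_le (hF : IsProfile F d C) (ha : IsDrift a) : ∃ B, ∀ N, 1 ≤ N →
    gapEnergy F a N ≤ (∫ x in Ioi 0, F x) / (4 * a N) + d / 2 * Real.log (a N) + B := by
  set c := 4 * (1 + rateConst a) with hc
  have hκ := ha.rateConst_pos
  refine ⟨d / 2 * Real.log c + C, fun N hN => ?_⟩
  have hx0 := ha.pos N hN
  have hx1 := ha.lt_half N hN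
  have hh := ha.climbRate_pos hN
  have h1 : gapEnergy F a N ≤ ∑ k ∈ Finset.range N, F (climbRate (a N) * (k + 1)) := by
    refine Finset.sum_le_sum fun k hk => ?_
    rw [Finset.mem_range] at hk
    have hle : climbRate (a N) ≤ climbRate (a (N - k)) :=
      climbRate_mono hx0 (ha.anti _ _ (by omega) (by omega)) (ha.lt_half _ (by omega))
    have hk0 : (0 : ℝ) < k + 1 := by positivity
    exact hF.antitoneOn (mul_pos hh hk0) (mul_pos (hh.trans_le hle) hk0)
      (mul_le_mul_of_nonneg_right hle hk0.le)
  have h2 := hF.sum_le _ hh N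
  have hK : 0 ≤ ∫ x in Ioi 0, F x := setIntegral_nonneg measurableSet_Ioi hF.nonneg
  have h3 : (∫ x in Ioi 0, F x) / climbRate (a N) ≤ (∫ x in Ioi 0, F x) / (4 * a N) :=
    div_le_div_of_nonneg_left hK (by positivity) (le_climbRate hx0 hx1)
  have h4 : Real.log (climbRate (a N)) ≤ Real.log c + Real.log (a N) := by
    rw [← Real.log_mul (by positivity) hx0.ne']
    refine Real.log_le_log hh ((ha.climbRate_le hN).trans ?_)
    have h5 : a N ^ 2 ≤ 1 := by nlinarith
    calc 4 * a N * (1 + rateConst a * a N ^ 2) ≤ 4 * a N * (1 + rateConst a * 1) := by gcongr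
      _ = c * a N := by rw [hc]; ring
  have h5 : (d : ℝ) / 2 * Real.log (climbRate (a N)) ≤ d / 2 * (Real.log c + Real.log (a N)) :=
    mul_le_mul_of_nonneg_left h4 (by positivity)
  linarith

lemma gapEnergy_ge_partial (hF : IsProfile F d C) (ha : IsDrift a) {N M : ℕ} (hM : M ≤ N) :
    ∑ k ∈ Finset.range M, F (climbRate (a (N - k)) * (k + 1)) ≤ gapEnergy F a N := by
  refine Finset.sum_le_sum_of_subset_of_nonneg (Finset.range_subset_range.2 hM) fun k hk _ => ?_
  rw [Finset.mem_range] at hk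
  exact hF.nonneg _ (mul_pos (ha.climbRate_pos (by omega)) (by positivity))

/-- Only the half of the sites nearest to `N` is kept, where the relative error of `4 * a N` is `O(k
/ N + a N ^ 2)`. The slope bound on `F` makes the weighted errors sum to `O(1 + 1 / (N * a N ^ 2))`.
-/
lemma le_gapEnergy (hF : IsProfile F d C) (ha : IsDrift a) : ∃ B, 0 ≤ B ∧ ∀ N : ℕ, 1 ≤ N →
    (∫ x in Ioi 0, F x) / (4 * a N) + d / 2 * Real.log (a N) - B * (1 + 1 / (N * a N ^ 2)) ≤
      gapEnergy F a N := by
  have hκ := ha.rateConst_pos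
  have hC := hF.const_nonneg
  set c := 4 + 18 * rateConst a with hc
  have hc0 : 0 < c := by positivity
  refine ⟨3 * C + C * c, by positivity, fun N hN => ?_⟩
  have hx0 := ha.pos N hN
  have hx1 := ha.lt_half N hN
  set x := a N with hx
  have hN0 : (0 : ℝ) < N := by exact_mod_cast hN
  -- The largest `M` with `2 * M + 1 ≤ N`, the range in which the concavity estimate holds.
  obtain ⟨M, hM⟩ : ∃ M, M = (N - 1) / 2 := ⟨_, rfl⟩
  have hMN : (N : ℝ) ≤ 2 * (M + 1) := by exact_mod_cast (show N ≤ 2 * (M + 1) by omega)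
  have h1 := gapEnergy_ge_partial hF ha (show M + 1 ≤ N by omega)
  have h2 := hF.le_sum (4 * x) (by positivity) M
  have h3 : ∀ k ∈ Finset.range (M + 1), F (4 * x * (k + 1)) -
      C * c * ((k / N + x ^ 2) * Real.exp (-(2 * x * (k + 1)))) ≤
        F (climbRate (a (N - k)) * (k + 1)) := by
    intro k hk
    rw [Finset.mem_range] at hk
    have hk1 : 2 * k + 1 ≤ N := by omega
    have hk0 : (0 : ℝ) < k + 1 := by positivity
    have hε : 0 ≤ c * (k / N + x ^ 2) := by positivity
    set y := 4 * x * (k + 1) with hy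
    have hy0 : 0 < y := by positivity
    have hle : climbRate (a (N - k)) * (k + 1) ≤ y * (1 + c * (k / N + x ^ 2)) := by
      have := mul_le_mul_of_nonneg_right (ha.climbRate_le_mul hk1) hk0.le
      calc _ ≤ _ := this
        _ = _ := by rw [hy]; ring
    have hyε : y ≤ y * (1 + c * (k / N + x ^ 2)) := le_mul_of_one_le_right hy0.le (by linarith)
    have h4 := hF.antitoneOn (mul_pos (ha.climbRate_pos (show 1 ≤ N - k by omega)) hk0)
      (hy0.trans_le hyε) hle
    have h5 := hF.sub_le _ _ hy0 hyε
    have h6 := div_exp_sub_one_le hy0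
    have h7 : C * ((y * (1 + c * (k / N + x ^ 2)) - y) / (Real.exp y - 1)) ≤
        C * c * ((k / N + x ^ 2) * Real.exp (-(2 * x * (k + 1)))) := by
      rw [show -(2 * x * ((k : ℝ) + 1)) = -(y / 2) by rw [hy]; ring]
      calc _ = C * c * ((k / N + x ^ 2) * (y / (Real.exp y - 1))) := by ring
        _ ≤ _ := by gcongr
    linarith
  have h4 := Finset.sum_le_sum h3
  rw [Finset.sum_sub_distrib, ← Finset.mul_sum] at h4
  have h5 : ∑ k ∈ Finset.range (M + 1), ((k / N + x ^ 2) * Real.exp (-(2 * x * (k + 1)))) ≤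
      1 + 1 / (N * x ^ 2) := by
    have e1 : ∑ k ∈ Finset.range (M + 1), ((k / N + x ^ 2) * Real.exp (-(2 * x * (k + 1)))) =
        1 / N * (∑ k ∈ Finset.range (M + 1), (k : ℝ) * Real.exp (-(2 * x * (k + 1)))) +
        x ^ 2 * ∑ k ∈ Finset.range (M + 1), Real.exp (-(2 * x * (k + 1))) := by
      rw [Finset.mul_sum, Finset.mul_sum, ← Finset.sum_add_distrib]
      exact Finset.sum_congr rfl fun k _ => by ring
    have e2 := mul_le_mul_of_nonneg_left (sum_mul_exp_le hx0 (M + 1))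
      (show 0 ≤ 1 / (N : ℝ) by positivity)
    have e3 := mul_le_mul_of_nonneg_left (sum_exp_le (show 0 < 2 * x by positivity) (M + 1))
      (sq_nonneg x)
    have e4 : x ^ 2 * (1 / (2 * x)) ≤ 1 := by
      rw [show x ^ 2 * (1 / (2 * x)) = x / 2 by field_simp]; linarith
    have e5 : 1 / (N : ℝ) * (1 / x ^ 2) = 1 / (N * x ^ 2) := by field_simp
    linarith
  have h6 := mul_le_mul_of_nonneg_left h5 (show 0 ≤ C * c by positivity)
  have h7 : C / ((M + 1) * (4 * x) ^ 2) ≤ C * (1 / (N * x ^ 2)) := by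
    rw [← div_eq_mul_one_div]
    refine div_le_div_of_nonneg_left hC (by positivity) ?_
    have : 0 ≤ x ^ 2 := sq_nonneg x
    nlinarith
  have h8 : Real.log x ≤ Real.log (4 * x) := Real.log_le_log hx0 (by linarith)
  have h9 : (d : ℝ) / 2 * Real.log x ≤ d / 2 * Real.log (4 * x) :=
    mul_le_mul_of_nonneg_left h8 (by positivity)
  have h10 : C * (1 + 4 * x) ≤ C * 3 := mul_le_mul_of_nonneg_left (by linarith) hC
  have h11 : 0 ≤ C * (1 / (N * x ^ 2)) := by positivity
  have h12 : (3 * C + C * c) * (1 + 1 / (N * x ^ 2)) = 3 * C + 3 * (C * (1 / (N * x ^ 2))) +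
    C * c * (1 + 1 / (N * x ^ 2)) := by ring
  linarith

/-- If `a N ≤ 1 / √N`, the first `√N` arguments stay below a constant `b`, so each of these terms is
at least `F b`. -/
lemma sqrt_le_gapEnergy (hF : IsProfile F d C) (hpos : ∀ x, 0 < x → 0 < F x) (ha : IsDrift a) :
    ∃ c, 0 < c ∧ ∀ N : ℕ, 1 ≤ N → N * a N ^ 2 ≤ 1 → c * Nat.sqrt N ≤ gapEnergy F a N := by
  have hκ := ha.rateConst_pos
  set b := 4 * (1 + (4 + 18 * rateConst a)) with hb
  have hb0 : 0 < b := by positivity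
  refine ⟨F b, hpos b hb0, fun N hN hNa => ?_⟩
  set s := Nat.sqrt N with hs
  have hs2 : s * s ≤ N := Nat.sqrt_le N
  have hx0 := ha.pos N hN
  have hsN : 2 * s ≤ N + 1 := by nlinarith [sq_nonneg ((s : ℤ) - 1)]
  have hsx : s * a N ≤ 1 := by
    have : ((s : ℝ) * a N) ^ 2 ≤ 1 := by
      calc ((s : ℝ) * a N) ^ 2 = ((s * s : ℕ) : ℝ) * a N ^ 2 := by push_cast; ring
        _ ≤ N * a N ^ 2 := by gcongr
        _ ≤ 1 := hNa
    exact (sq_le_one_iff₀ (by positivity)).1 this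
  refine le_trans ?_ (gapEnergy_ge_partial hF ha (show s ≤ N by omega))
  rw [mul_comm, ← nsmul_eq_mul]
  refine le_trans (le_of_eq (by simp)) (Finset.sum_le_sum (f := fun _ => F b) fun k hk => ?_)
  rw [Finset.mem_range] at hk
  have hk0 : (0 : ℝ) < k + 1 := by positivity
  refine hF.antitoneOn (mul_pos (ha.climbRate_pos (by omega)) hk0) hb0 ?_
  have hks : (k : ℝ) + 1 ≤ s := by exact_mod_cast hk
  calc climbRate (a (N - k)) * (k + 1) ≤ b * a N * s := by
        gcongr
        exact ha.climbRate_le_const_mul (by omega)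
    _ = b * (s * a N) := by ring
    _ ≤ b * 1 := by gcongr
    _ = b := mul_one b

/-- The series of the gap probabilities and the explicit series diverge simultaneously. -/
lemma tsum_exp_neg_gapEnergy_eq_top_iff (hF : IsProfile F d C) (hpos : ∀ x, 0 < x → 0 < F x)
    (ha : IsDrift a) :
    ∑' n : ℕ, ENNReal.ofReal (Real.exp (-gapEnergy F a (n + 1))) = ⊤ ↔
      ∑' n : ℕ, ENNReal.ofReal (Real.exp (-((∫ x in Ioi 0, F x) / (4 * a (n + 1)))) /
        a (n + 1) ^ ((d : ℝ) / 2)) = ⊤ := by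
  set t : ℕ → ℝ := fun n => Real.exp (-((∫ x in Ioi 0, F x) / (4 * a (n + 1)))) /
        a (n + 1) ^ ((d : ℝ) / 2) with ht
  have hx0 : ∀ n, 0 < a (n + 1) := fun n => ha.pos _ (by omega)
  have ht' : ∀ n, t n = _ := fun n => exp_neg_div_rpow (hx0 n)
  obtain ⟨B₁, h₁⟩ := gapEnergy_le hF ha
  obtain ⟨B₂, hB₂, h₂⟩ := le_gapEnergy hF ha
  obtain ⟨c, hc, h₃⟩ := sqrt_le_gapEnergy hF hpos ha
  have hlow : ∀ n, ENNReal.ofReal (t n) ≤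
      ENNReal.ofReal (Real.exp B₁) * ENNReal.ofReal (Real.exp (-gapEnergy F a (n + 1))) := by
    intro n
    rw [← ENNReal.ofReal_mul (Real.exp_pos _).le, ← Real.exp_add, ht']
    refine ENNReal.ofReal_le_ofReal (Real.exp_le_exp.2 ?_)
    linarith [h₁ (n + 1) (by omega)]
  have hup : ∀ n, ENNReal.ofReal (Real.exp (-gapEnergy F a (n + 1))) ≤
      ENNReal.ofReal (Real.exp (2 * B₂)) * ENNReal.ofReal (t n) +
        ENNReal.ofReal (Real.exp (-(c * Nat.sqrt (n + 1)))) := by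
    intro n
    -- For small drift the energy alone makes the term summable; otherwise the error in the lower
    -- bound is at most `2 * B₂`.
    rcases le_total (((n + 1 : ℕ) : ℝ) * a (n + 1) ^ 2) 1 with h | h
    · refine le_add_left (ENNReal.ofReal_le_ofReal (Real.exp_le_exp.2 ?_))
      linarith [h₃ (n + 1) (by omega) h]
    · refine le_add_right ?_
      rw [← ENNReal.ofReal_mul (Real.exp_pos _).le, ht', ← Real.exp_add]
      refine ENNReal.ofReal_le_ofReal (Real.exp_le_exp.2 ?_)
      have h4 := h₂ (n + 1) (by omega)
      have h5 : 1 / (((n + 1 : ℕ) : ℝ) * a (n + 1) ^ 2) ≤ 1 := by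
        rw [div_le_one (by linarith)]; exact h
      have h6 := mul_le_mul_of_nonneg_left (add_le_add_right h5 1) hB₂
      linarith
  have hs : ∑' n : ℕ, ENNReal.ofReal (Real.exp (-(c * Nat.sqrt (n + 1)))) ≠ ⊤ :=
    ((summable_nat_add_iff 1).2 (summable_exp_neg_sqrt hc)).tsum_ofReal_ne_top
  constructor
  · intro h
    have h1 := ENNReal.tsum_le_tsum hup
    rw [h, ENNReal.tsum_add, ENNReal.tsum_mul_left, top_le_iff, ENNReal.add_eq_top] at h1
    rcases h1 with h1 | h1
    · rw [ENNReal.mul_eq_top] at h1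
      rcases h1 with h1 | h1
      · exact h1.2
      · exact absurd h1.1 ENNReal.ofReal_ne_top
    · exact absurd h1 hs
  · intro h
    have h1 := ENNReal.tsum_le_tsum hlow
    rw [h, ENNReal.tsum_mul_left, top_le_iff, ENNReal.mul_eq_top] at h1
    rcases h1 with h1 | h1
    · exact h1.2
    · exact absurd h1.1 ENNReal.ofReal_ne_top

end Comparison

/-! ### The generating function and its logarithmic profile. -/

section GeneratingFunction

open Set

lemma pow_sub_pow_le_mul {z w : ℝ} (h0 : 0 ≤ z) (hzw : z ≤ w) (h1 : w ≤ 1) (k : ℕ) :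
    w ^ k - z ^ k ≤ k * (w - z) := by
  induction k with
  | zero => simp
  | succ k ih =>
    have hz : z ^ k ≤ 1 := pow_le_one₀ h0 (hzw.trans h1)
    have hk : 0 ≤ w ^ k - z ^ k := sub_nonneg.2 (pow_le_pow_left₀ h0 hzw k)
    rw [pow_succ, pow_succ]
    push_cast
    nlinarith

variable {Ω : Type*} [MeasurableSpace Ω] {P : Measure Ω} [IsProbabilityMeasure P] {Y : Ω → ℕ}

omit [IsProbabilityMeasure P] in
lemma genFun_eq_pow_mul {d : ℕ} (hd : ∀ᵐ ω ∂P, d ≤ Y ω) (z : ℝ) :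
    genFun P Y z = z ^ d * genFun P (fun ω => Y ω - d) z := by
  rw [genFun, genFun, ← integral_const_mul]
  refine integral_congr_ae (hd.mono fun ω hω => ?_)
  simp only
  rw [← pow_add, Nat.add_sub_cancel' hω]

lemma genFun_one : genFun P Y 1 = 1 := by simp [genFun]

/-- Finite mean enters here, as a Lipschitz constant of the generating function on `[0, 1]`. -/
lemma genFun_sub_le (hY : Measurable Y) (hint : Integrable (fun ω => (Y ω : ℝ)) P) {z w : ℝ}
    (h0 : 0 ≤ z) (hzw : z ≤ w) (h1 : w ≤ 1) :
    genFun P Y w - genFun P Y z ≤ (∫ ω, (Y ω : ℝ) ∂P) * (w - z) := by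
  have hiw := integrable_pow (P := P) hY (h0.trans hzw) h1
  have hiz := integrable_pow (P := P) hY h0 (hzw.trans h1)
  rw [genFun, genFun, ← integral_sub hiw hiz, ← integral_mul_const]
  exact integral_mono (hiw.sub hiz) (hint.mul_const _) fun ω => pow_sub_pow_le_mul h0 hzw h1 _

lemma measureReal_eq_zero_le_genFun (hY : Measurable Y) {z : ℝ} (h0 : 0 ≤ z) (h1 : z ≤ 1) :
    P.real {ω | Y ω = 0} ≤ genFun P Y z := by
  have hm : MeasurableSet {ω | Y ω = 0} := hY (measurableSet_singleton 0)
  rw [← integral_indicator_one hm, genFun]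
  refine integral_mono ((integrable_const (1 : ℝ)).indicator hm) (integrable_pow hY h0 h1)
    fun ω => ?_
  by_cases hω : Y ω = 0
  · simp [Set.indicator, hω]
  · simp [Set.indicator, hω, pow_nonneg h0]

/-- Uses `z ^ k ≤ z` for `k ≥ 1`; it makes the generating function less than `1` below `1`, hence
the profile positive. -/
lemma genFun_le (hY : Measurable Y) {z : ℝ} (h0 : 0 ≤ z) (h1 : z ≤ 1) :
    genFun P Y z ≤ 1 - (1 - z) * P.real {ω | Y ω ≠ 0} := by
  have hm : MeasurableSet {ω | Y ω ≠ 0} := hY (measurableSet_singleton 0).compl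
  have hi : Integrable ({ω | Y ω ≠ 0}.indicator (1 : Ω → ℝ)) P :=
    (integrable_const (1 : ℝ)).indicator hm
  have : genFun P Y z ≤ ∫ ω, (1 - (1 - z) * {ω | Y ω ≠ 0}.indicator (1 : Ω → ℝ) ω) ∂P := by
    refine integral_mono (integrable_pow hY h0 h1) ((integrable_const _).sub (hi.const_mul _))
      fun ω => ?_
    by_cases hω : Y ω = 0
    · simp [Set.indicator, hω]
    · simp only [Set.indicator, Set.mem_ofPred_eq, hω, ne_eq, not_false_eq_true, if_true,
        Pi.one_apply, mul_one, sub_sub_cancel]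
      exact pow_le_of_le_one h0 h1 hω
  rw [integral_sub (integrable_const _) (hi.const_mul _), integral_const_mul,
    integral_indicator_one hm] at this
  simpa using this

/-- The function `x ↦ -log f (1 - e^{-x})`, where `f` is the generating function of `Y`. -/
noncomputable def genProfile (P : Measure Ω) (Y : Ω → ℕ) (x : ℝ) : ℝ :=
  -Real.log (genFun P Y (1 - Real.exp (-x)))

lemma genFun_pos {d : ℕ} (hY : Measurable Y) (hd : ∀ᵐ ω ∂P, d ≤ Y ω)
    (hd0 : 0 < P {ω | Y ω = d}) {z : ℝ} (h0 : 0 < z) (h1 : z ≤ 1) :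
    0 < P.real {ω | Y ω = d} ∧ P.real {ω | Y ω = d} ≤ genFun P (fun ω => Y ω - d) z ∧
      0 < genFun P Y z := by
  have hc : 0 < P.real {ω | Y ω = d} := ENNReal.toReal_pos hd0.ne' (measure_ne_top _ _)
  have hle : P.real {ω | Y ω = d} ≤ genFun P (fun ω => Y ω - d) z := by
    refine le_trans (measureReal_mono fun ω hω => ?_)
      (measureReal_eq_zero_le_genFun (hY.sub_const d) h0.le h1)
    simp only [Set.mem_ofPred_eq] at hω ⊢
    omega
  refine ⟨hc, hle, ?_⟩
  rw [genFun_eq_pow_mul hd]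
  exact mul_pos (pow_pos h0 d) (hc.trans_le hle)

/-- Factor `f z = z ^ d * E[z ^ (Y - d)]`. The power gives `d * logGap`; the second factor is at
least `P(Y = d) > 0`, so its logarithm is bounded and inherits the Lipschitz bound. -/
lemma exists_isProfile_genProfile {d : ℕ} (hY : Measurable Y)
    (hint : Integrable (fun ω => (Y ω : ℝ)) P) (hd : ∀ᵐ ω ∂P, d ≤ Y ω)
    (hd0 : 0 < P {ω | Y ω = d}) : ∃ C, IsProfile (genProfile P Y) d C := by
  set Z : Ω → ℕ := fun ω => Y ω - d with hZ
  have hZm : Measurable Z := hY.sub_const d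
  have hZi : Integrable (fun ω => (Z ω : ℝ)) P := by
    refine Integrable.mono' hint
      ((measurable_of_countable (fun k : ℕ => (k : ℝ))).comp hZm).aestronglyMeasurable
      (Filter.Eventually.of_forall fun ω => ?_)
    rw [Real.norm_of_nonneg (Nat.cast_nonneg _)]
    exact_mod_cast Nat.sub_le _ _
  set c := P.real {ω | Y ω = d} with hc
  have hc0 : 0 < c := (genFun_pos hY hd hd0 zero_lt_one le_rfl).1
  set m := ∫ ω, (Z ω : ℝ) ∂P with hm
  have hm0 : 0 ≤ m := integral_nonneg fun ω => Nat.cast_nonneg _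
  set φ : ℝ → ℝ := fun x => genFun P Z (1 - Real.exp (-x)) with hφ
  have hφc : ∀ x, 0 < x → c ≤ φ x := fun x hx =>
    (genFun_pos hY hd hd0 (one_sub_exp_neg_pos hx) (one_sub_exp_neg_lt_one x).le).2.1
  have hφ0 : ∀ x, 0 < x → 0 < φ x := fun x hx => hc0.trans_le (hφc x hx)
  have hφ1 : ∀ x, 0 < x → φ x ≤ 1 := fun x hx => by
    rw [← genFun_one (P := P) (Y := Z)]
    exact genFun_mono hZm (one_sub_exp_neg_pos hx).le (one_sub_exp_neg_lt_one x).le le_rfl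
  have hφm : ∀ x y, 0 < x → x ≤ y → φ x ≤ φ y := fun x y hx hxy =>
    genFun_mono hZm (one_sub_exp_neg_pos hx).le
      (by linarith [Real.exp_le_exp.2 (neg_le_neg hxy)]) (one_sub_exp_neg_lt_one y).le
  have hlog : ∀ x, 0 < x → ∀ u, φ x ≤ u → Real.log u - Real.log (φ x) ≤ (u - φ x) / c := by
    intro x hx u hu
    have hu0 := (hφ0 x hx).trans_le hu
    have h1 := Real.log_le_sub_one_of_pos (div_pos hu0 (hφ0 x hx))
    rw [Real.log_div hu0.ne' (hφ0 x hx).ne'] at h1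
    have h2 : u / φ x - 1 = (u - φ x) / φ x := by
      have := (hφ0 x hx).ne'
      field_simp
    rw [h2] at h1
    exact h1.trans (div_le_div_of_nonneg_left (sub_nonneg.2 hu) hc0 (hφc x hx))
  refine exists_isProfile (G := fun x => -Real.log (φ x)) (A := -Real.log c) (B := m / c)
    (neg_nonneg.2 (Real.log_nonpos hc0.le measureReal_le_one)) (by positivity)
    (fun x hx => ?_) (fun x hx => ?_) (fun x hx => ?_) (fun x hx y hy hxy => ?_)
    (fun x hx => ?_) (fun x y hx hxy => ?_)
  · rw [genProfile, genFun_eq_pow_mul hd, Real.log_mul (pow_pos (one_sub_exp_neg_pos hx) d).ne'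
      (hφ0 x hx).ne', Real.log_pow, logGap]
    ring
  · exact neg_nonneg.2 (Real.log_nonpos (hφ0 x hx).le (hφ1 x hx))
  · exact neg_le_neg (Real.log_le_log hc0 (hφc x hx))
  · exact neg_le_neg (Real.log_le_log (hφ0 x hx) (hφm x y hx hxy))
  · have h1 := hlog x hx 1 (hφ1 x hx)
    have h2 := genFun_sub_le hZm hZi (one_sub_exp_neg_pos hx).le (one_sub_exp_neg_lt_one x).le le_rfl
    rw [genFun_one, sub_sub_cancel] at h2
    rw [Real.log_one] at h1
    calc -Real.log (φ x) ≤ (1 - φ x) / c := by linarith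
      _ ≤ m * Real.exp (-x) / c := div_le_div_of_nonneg_right h2 hc0.le
      _ = _ := by ring
  · have h1 := hlog x hx (φ y) (hφm x y hx hxy)
    have h2 := genFun_sub_le hZm hZi (one_sub_exp_neg_pos hx).le
      (show 1 - Real.exp (-x) ≤ 1 - Real.exp (-y) by
        linarith [Real.exp_le_exp.2 (neg_le_neg hxy)]) (one_sub_exp_neg_lt_one y).le
    calc -Real.log (φ x) - -Real.log (φ y) ≤ (φ y - φ x) / c := by linarith
      _ ≤ m * (1 - Real.exp (-y) - (1 - Real.exp (-x))) / c :=
          div_le_div_of_nonneg_right h2 hc0.le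
      _ = _ := by ring

lemma genProfile_pos {d : ℕ} (hY : Measurable Y) (hd : ∀ᵐ ω ∂P, d ≤ Y ω)
    (hd0 : 0 < P {ω | Y ω = d}) (h0 : 0 < P {ω | Y ω ≠ 0}) {x : ℝ} (hx : 0 < x) :
    0 < genProfile P Y x := by
  have hz := one_sub_exp_neg_pos hx
  have hz1 := (one_sub_exp_neg_lt_one x).le
  refine neg_pos.2 (Real.log_neg (genFun_pos hY hd hd0 hz hz1).2.2 ?_)
  refine (genFun_le hY hz.le hz1).trans_lt ?_
  rw [sub_sub_cancel]
  have : 0 < P.real {ω | Y ω ≠ 0} := ENNReal.toReal_pos h0.ne' (measure_ne_top _ _)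
  linarith [mul_pos (Real.exp_pos (-x)) this]

lemma genFun_eq_exp_neg_genProfile {d : ℕ} (hY : Measurable Y) (hd : ∀ᵐ ω ∂P, d ≤ Y ω)
    (hd0 : 0 < P {ω | Y ω = d}) {x : ℝ} (hx : 0 < x) :
    genFun P Y (1 - Real.exp (-x)) = Real.exp (-genProfile P Y x) := by
  rw [genProfile, neg_neg, Real.exp_log]
  exact (genFun_pos hY hd hd0 (one_sub_exp_neg_pos hx) (one_sub_exp_neg_lt_one x).le).2.2

end GeneratingFunction

/-! ### Gap probabilities in exponential form, and the theorem. -/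

section Main

variable {Ω : Type*} [MeasurableSpace Ω] {P : Measure Ω} [IsProbabilityMeasure P]
  {X : ℕ → Ω → ℕ} {S : ℕ → ℕ → ℕ → Ω → ℤ} {p a : ℕ → ℝ} {d : ℕ}

omit [IsProbabilityMeasure P] in
lemma IsNonhomogeneous.isDrift (h : IsNonhomogeneous P X S p)
    (ha : ∀ j, 1 ≤ j → p j = 1 / 2 + a j) (hconc : ConcaveSeq (fun j => 1 / a j)) : IsDrift a where
  pos j hj := by linarith [h.half_lt j, ha j hj]
  lt_half j hj := by linarith [h.lt_one j, ha j hj]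
  anti i j hi hij := by
    induction j, hij using Nat.le_induction with
    | base => exact le_rfl
    | succ j hj ih =>
      linarith [h.antitone j (by omega), ha j (by omega), ha (j + 1) (by omega)]
  concave := hconc

lemma IsNonhomogeneous.measure_gapSet_one_eq_exp (h : IsNonhomogeneous P X S p)
    (hident : ∀ j, 1 ≤ j → IdentDistrib (X j) (X 1) P P)
    (ha : ∀ j, 1 ≤ j → p j = 1 / 2 + a j) (hconc : ConcaveSeq (fun j => 1 / a j))
    (hd : ∀ᵐ ω ∂P, d ≤ X 1 ω) (hd0 : 0 < P {ω | X 1 ω = d}) (N : ℕ) :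
    P (gapSet X S 1 (N + 1)) =
      ENNReal.ofReal (Real.exp (-gapEnergy (genProfile P (X 1)) a N)) := by
  have hdr := h.isDrift ha hconc
  rw [h.measure_gapSet_one hident, gapEnergy, ← Finset.sum_neg_distrib, Real.exp_sum]
  congr 1
  refine Finset.prod_congr rfl fun k hk => ?_
  rw [Finset.mem_range] at hk
  have hj : 1 ≤ N - k := by omega
  rw [← genFun_eq_exp_neg_genProfile (h.measurable_count 1 le_rfl) hd hd0
    (mul_pos (hdr.climbRate_pos hj) (by positivity)), climbRatio, ha _ hj,
    ← exp_neg_climbRate (hdr.pos _ hj) (hdr.lt_half _ hj), ← Real.exp_nat_mul]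
  congr 3
  push_cast
  ring

end Main

end FrogModel

theorem theorem3p1 {Ω : Type*} [MeasurableSpace Ω] (P : Measure Ω) [IsProbabilityMeasure P]
    (X : ℕ → Ω → ℕ) (S : ℕ → ℕ → ℕ → Ω → ℤ) (p a : ℕ → ℝ) (d : ℕ)
    (hmodel : FrogModel.IsNonhomogeneous P X S p)
    (hident : ∀ j, 1 ≤ j → IdentDistrib (X j) (X 1) P P)
    (hmean : Integrable (fun ω => (X 1 ω : ℝ)) P)
    (ha : ∀ j, 1 ≤ j → p j = 1 / 2 + a j)
    (hconc : FrogModel.ConcaveSeq (fun j => 1 / a j))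
    (hd : IsLeast {k : ℕ | 0 < P {ω | X 1 ω = k}} d) :
    IntegrableOn (fun x : ℝ => Real.log (FrogModel.genFun P (X 1) (1 - Real.exp (-x))))
        (Set.Ioi 0) volume ∧
      (FrogModel.Transient P X S ↔
        ∑' n : ℕ, ENNReal.ofReal
          (Real.exp (-(FrogModel.logConst P (X 1) / (4 * a (n + 1)))) /
            a (n + 1) ^ ((d : ℝ) / 2)) = ⊤) := by
  have hY := hmodel.measurable_count 1 le_rfl
  have hd0 : 0 < P {ω | X 1 ω = d} := hd.1
  have hdae : ∀ᵐ ω ∂P, d ≤ X 1 ω := by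
    have : ∀ k : ℕ, ∀ᵐ ω ∂P, k < d → X 1 ω ≠ k := by
      intro k
      by_cases hk : k < d
      · have h0 : P {ω | X 1 ω = k} = 0 := by
          by_contra hne
          exact absurd (hd.2 (pos_iff_ne_zero.2 hne)) (not_le.2 hk)
        filter_upwards [measure_eq_zero_iff_ae_notMem.1 h0] with ω hω _ using hω
      · exact Filter.Eventually.of_forall fun ω h => absurd h hk
    filter_upwards [ae_all_iff.2 this] with ω hω
    by_contra hlt
    exact hω _ (not_le.1 hlt) rfl
  obtain ⟨C, hC⟩ := FrogModel.exists_isProfile_genProfile hY hmean hdae hd0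
  have hK : FrogModel.logConst P (X 1) = ∫ x in Set.Ioi 0, FrogModel.genProfile P (X 1) x := by
    rw [FrogModel.logConst, ← integral_neg]
    rfl
  refine ⟨?_, ?_⟩
  · have := hC.integrableOn.neg
    refine IntegrableOn.congr_fun this (fun x _ => ?_) measurableSet_Ioi
    simp [FrogModel.genProfile]
  -- The term `N = 0` is the probability of a gap over an empty interval; being finite, it is split
  -- off so that both series start at the site `1`.
  · rw [hmodel.transient_iff hident, hK, ← FrogModel.tsum_exp_neg_gapEnergy_eq_top_iff hC
      (fun x hx => FrogModel.genProfile_pos hY hdae hd0 (hmodel.count_nonzero 1 le_rfl) hx)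
      (hmodel.isDrift ha hconc), tsum_eq_zero_add' ENNReal.summable, ENNReal.add_eq_top,
      or_iff_right (measure_ne_top _ _)]
    simp only [hmodel.measure_gapSet_one_eq_exp hident ha hconc hdae hd0]
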